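/- Let $n\ge 1$ and let $\mathbb T^n=\mathbb R^n/\mathbb Z^n$, with the Euclidean quotient distance $|x-y|$, where $|x|=\inf\{|p|_{\mathbb R^n}: p \text{ represents } x\}$. Let $W:\mathbb R^n\to\mathbb R$ be convex with $W\in C^2(\mathbb R^n\setminus\{0\})$ and $W^2$ strictly convex, and suppose that there is $\lambda_0>0$ such that $W(ap)=aW(p)\ge\lambda_0 a|p|$ for all $p\in\mathbb R^n$ and $a\ge 0$. Let $E:L^2(\mathbb T^n)\to[0,\infty]$ be the anisotropic total variation energy: $E(\psi)=\int_{\mathbb T^n}W(\nabla\psi)$ if $\psi\in L^2(\mathbb T^n)\cap BV(\mathbb T^n)$, and $E(\psi)=+\infty$ if $\psi\in L^2(\mathbb T^n)\setminus BV(\mathbb T^n)$. Here $\int_{\mathbb T^n} W(\nabla\psi)$ is the total mass of the measure $W(D\psi)=W(\nabla\psi)\,dx+W\!\left(\frac{D^s\psi}{|D^s\psi|}\right)|D^s\psi|$, where $D\psi=\nabla\psi\,dx+D^s\psi$ is the Lebesgue decomposition of the distributional gradient. Let $\partial E(\psi)=\{v\in L^2(\mathbb T^n): E(\psi+h)-E(\psi)\ge\langle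 h,v\rangle_{L^2}\ \text{for all } h\in L^2(\mathbb T^n)\}$ be its subdifferential (empty where $E(\psi)=+\infty$), let $\operatorname{dom}(\partial E)=\{\psi:\partial E(\psi)\ne\emptyset\}$, and for $\psi\in\operatorname{dom}(\partial E)$ let $\partial^0E(\psi)$ be the unique element of $\partial E(\psi)$ of least $L^2$-norm. For $A\subset\mathbb T^n$ and $\rho>0$ put $\mathcal U^{\rho}(A)=A+\overline B_\rho(0)$ and $\mathcal U^{-\rho}(A)=\{x:\overline B_\rho(x)\subset A\}$. For pairs of disjoint subsets of $\mathbb T^n$ put $\mathcal U^\rho(A_-,A_+)=(\mathcal U^{-\rho}(A_-),\mathcal U^{\rho}(A_+))$, and write $(A_-,A_+)\preceq(B_-,B_+)$ if $A_+\subset B_+$ and $B_-\subset A_-$. A pair is open if both of its sets are open. A support function of an open pair $(A_-,A_+)$ is a Lipschitz function $\psi:\mathbb T^n\to\mathbb R$ with $\psi>0$ in $A_+$, $\psi<0$ in $A_-$ and $\psi=0$ in $(A_-\cup A_+)^c$. Let $(G_-,G_+)$ and $(H_-,H_+)$ be two open pairs of disjoint subsets of $\mathbb T^n$ that are strictly ordered,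 i.e. there exists $\delta>0$ such that $\mathcal U^\delta(G_-,G_+)\preceq(H_-,H_+)$. Then for any support function $\psi_G$ of $(G_-,G_+)$ and any support function $\psi_H$ of $(H_-,H_+)$ such that $\psi_G,\psi_H\in\operatorname{dom}(\partial E)$ we have $$-\partial^0E(\psi_G)\le-\partial^0E(\psi_H)\qquad\text{a.e. on } G_-^c\cap G_+^c\cap H_-^c\cap H_+^c .$$ -/

import Mathlib

open MeasureTheory Set
open scoped ENNReal ContDiff Pointwise

noncomputable section

/-! ### Subdifferentials on a real Hilbert space -/

section Subdifferential

variable {H : Type*} [NormedAddCommGroup H] [InnerProductSpace ℝ H]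

/-- The subdifferential of `Φ : H → [-∞, ∞]` at `x`: all `v` such that
`Φ (x + h) - Φ x ≥ ⟨h, v⟩` for every `h`. (It is written additively, so that the inequality also
makes sense where `Φ` is infinite; a proper `Φ` has empty subdifferential where it is `+∞`.) -/
def subdifferential (Φ : H → EReal) (x : H) : Set H :=
  {v | ∀ h : H, Φ x + ((inner ℝ h v : ℝ) : EReal) ≤ Φ (x + h)}

/-- The domain of the subdifferential. -/
def subdifferentialDom (Φ : H → EReal) : Set H :=
  {x | (subdifferential Φ x).Nonempty}

theorem subdifferential_halfspace (Φ : H → EReal) (x h : H) :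
    {v : H | Φ x + ((inner ℝ h v : ℝ) : EReal) ≤ Φ (x + h)} = ∅ ∨
      {v : H | Φ x + ((inner ℝ h v : ℝ) : EReal) ≤ Φ (x + h)} = univ ∨
      ∃ c : ℝ, {v : H | Φ x + ((inner ℝ h v : ℝ) : EReal) ≤ Φ (x + h)} =
        {v | inner ℝ h v ≤ c} := by
  induction Φ x using EReal.rec with
  | bot => right; left; ext v; simp
  | top =>
    by_cases hb : Φ (x + h) = ⊤
    · right; left; ext v; simp [hb]
    · left; ext v; simp [hb]
  | coe a =>
    induction Φ (x + h) using EReal.rec with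
    | bot => left; ext v; simp [← EReal.coe_add]
    | top => right; left; ext v; simp
    | coe b =>
      right; right
      refine ⟨b - a, ?_⟩
      ext v
      simp only [mem_ofPred_eq, ← EReal.coe_add, EReal.coe_le_coe_iff]
      constructor <;> intro h <;> linarith

theorem subdifferential_eq_iInter (Φ : H → EReal) (x : H) :
    subdifferential Φ x = ⋂ h : H, {v : H | Φ x + ((inner ℝ h v : ℝ) : EReal) ≤ Φ (x + h)} := by
  ext v; simp [subdifferential]

theorem isClosed_subdifferential (Φ : H → EReal) (x : H) : IsClosed (subdifferential Φ x) := by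
  rw [subdifferential_eq_iInter]
  refine isClosed_iInter fun h => ?_
  rcases subdifferential_halfspace Φ x h with e | e | ⟨c, e⟩ <;> rw [e]
  · exact isClosed_empty
  · exact isClosed_univ
  · exact isClosed_le (by fun_prop) continuous_const

theorem convex_subdifferential (Φ : H → EReal) (x : H) : Convex ℝ (subdifferential Φ x) := by
  rw [subdifferential_eq_iInter]
  refine convex_iInter fun h => ?_
  rcases subdifferential_halfspace Φ x h with e | e | ⟨c, e⟩ <;> rw [e]
  · exact convex_empty
  · exact convex_univ
  · exact convex_halfSpace_le (innerₛₗ ℝ h).isLinear c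

/-- An element of the subdifferential of least norm exists and is unique. -/
theorem existsUnique_minimalSection [CompleteSpace H] (Φ : H → EReal) (x : H)
    (hx : x ∈ subdifferentialDom Φ) :
    ∃! v : H, v ∈ subdifferential Φ x ∧ ∀ w ∈ subdifferential Φ x, ‖v‖ ≤ ‖w‖ := by
  have hc := convex_subdifferential Φ x
  obtain ⟨v, hv, hmin⟩ := exists_norm_eq_iInf_of_complete_convex (K := subdifferential Φ x) hx
    (isClosed_subdifferential Φ x).isComplete hc 0
  have key := (norm_eq_iInf_iff_real_inner_le_zero hc hv).1 hmin
  have hle : ∀ w ∈ subdifferential Φ x, ‖v‖ ^ 2 + ‖w - v‖ ^ 2 ≤ ‖w‖ ^ 2 := by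
    intro w hw
    have h1 := key w hw
    have h2 : ‖w‖ ^ 2 = ‖v‖ ^ 2 + 2 * inner ℝ v (w - v) + ‖w - v‖ ^ 2 := by
      rw [← norm_add_sq_real]; simp
    rw [zero_sub, inner_neg_left] at h1
    linarith
  refine ⟨v, ⟨hv, fun w hw => ?_⟩, ?_⟩
  · have := hle w hw
    exact (sq_le_sq₀ (norm_nonneg v) (norm_nonneg w)).1 (by nlinarith [sq_nonneg ‖w - v‖])
  · rintro w ⟨hw, hwmin⟩
    have h1 := hle w hw
    have h2 : ‖w‖ ^ 2 ≤ ‖v‖ ^ 2 := pow_le_pow_left₀ (norm_nonneg w) (hwmin v hv) 2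
    have h3 : ‖w - v‖ ^ 2 = 0 := le_antisymm (by linarith) (sq_nonneg _)
    exact sub_eq_zero.1 (norm_eq_zero.1 ((pow_eq_zero_iff two_ne_zero).1 h3))

/-- The minimal section `∂⁰Φ(x)`: the element of least norm of `∂Φ(x)`, for `x ∈ dom(∂Φ)`. -/
def minimalSection [CompleteSpace H] (Φ : H → EReal) (x : H)
    (hx : x ∈ subdifferentialDom Φ) : H :=
  (existsUnique_minimalSection Φ x hx).choose

end Subdifferential

/-! ### The torus `ℝⁿ / ℤⁿ` -/

/-- The projection `ℝⁿ → 𝕋ⁿ`. -/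
def torusProj {n : ℕ} (p : EuclideanSpace ℝ (Fin n)) : UnitAddTorus (Fin n) :=
  fun i => (p i : UnitAddCircle)

/-- The Euclidean distance to the origin on the torus, `|x| = inf {|p| : p ∈ ℝⁿ represents x}`.
(The built-in norm of `UnitAddTorus` is the maximum norm.) -/
def torusNorm {n : ℕ} (x : UnitAddTorus (Fin n)) : ℝ :=
  ⨅ p : {p : EuclideanSpace ℝ (Fin n) // torusProj p = x}, ‖p.1‖

theorem torusNorm_eq {n : ℕ} (x : UnitAddTorus (Fin n)) :
    torusNorm x = √(∑ i, ‖x i‖ ^ 2) := by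
  have hrep : ∀ y : UnitAddCircle, ∃ t : ℝ, (t : UnitAddCircle) = y ∧ |t| = ‖y‖ := by
    intro y
    obtain ⟨t, rfl⟩ := QuotientAddGroup.mk_surjective y
    refine ⟨t - round t, ?_, ?_⟩
    · have : ((round t : ℝ) : UnitAddCircle) = 0 := by
        rw [AddCircle.coe_eq_zero_iff]; exact ⟨round t, by simp⟩
      change ((t - round t : ℝ) : UnitAddCircle) = (t : UnitAddCircle)
      rw [AddCircle.coe_sub, this, sub_zero]
    · exact (UnitAddCircle.norm_eq (x := t)).symm
  choose r hr hr' using hrep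
  have hmem : torusProj (WithLp.toLp 2 fun i => r (x i)) = x := by
    funext i; exact hr (x i)
  apply le_antisymm
  · refine (ciInf_le ⟨0, by rintro _ ⟨p, rfl⟩; exact norm_nonneg _⟩ ⟨_, hmem⟩).trans_eq ?_
    simp [EuclideanSpace.norm_eq, hr']
  · have : Nonempty {p : EuclideanSpace ℝ (Fin n) // torusProj p = x} := ⟨⟨_, hmem⟩⟩
    refine le_ciInf ?_
    rintro ⟨p, rfl⟩
    rw [EuclideanSpace.norm_eq]
    refine Real.sqrt_le_sqrt (Finset.sum_le_sum fun i _ => ?_)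
    refine pow_le_pow_left₀ (norm_nonneg _) ?_ 2
    exact QuotientAddGroup.norm_mk_le_norm

/-- The closed ball of radius `r` centred at `x`. -/
def torusClosedBall {n : ℕ} (x : UnitAddTorus (Fin n)) (r : ℝ) : Set (UnitAddTorus (Fin n)) :=
  {y | torusNorm (x - y) ≤ r}

/-- `ψ ∈ Lip(𝕋ⁿ)`. -/
def IsTorusLipschitz {n : ℕ} (ψ : UnitAddTorus (Fin n) → ℝ) : Prop :=
  ∃ K : ℝ, ∀ x y, |ψ x - ψ y| ≤ K * torusNorm (x - y)

theorem IsTorusLipschitz.continuous {n : ℕ} {ψ : UnitAddTorus (Fin n) → ℝ}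
    (h : IsTorusLipschitz ψ) : Continuous ψ := by
  obtain ⟨K, hK⟩ := h
  rw [continuous_iff_continuousAt]
  intro x
  have hc : Continuous fun y : UnitAddTorus (Fin n) => K * torusNorm (y - x) := by
    simp only [torusNorm_eq]; fun_prop
  have h0 : Filter.Tendsto (fun y : UnitAddTorus (Fin n) => K * torusNorm (y - x))
      (nhds x) (nhds 0) := by
    have := hc.tendsto x
    simpa [torusNorm_eq] using this
  rw [ContinuousAt, tendsto_iff_dist_tendsto_zero]
  exact squeeze_zero (fun _ => dist_nonneg) (fun y => by rw [Real.dist_eq]; exact hK y x) h0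

theorem IsTorusLipschitz.memLp {n : ℕ} {ψ : UnitAddTorus (Fin n) → ℝ}
    (h : IsTorusLipschitz ψ) : MemLp ψ 2 (volume : Measure (UnitAddTorus (Fin n))) := by
  obtain ⟨C, hC⟩ := isCompact_univ.exists_bound_of_continuousOn h.continuous.continuousOn
  exact MemLp.of_bound h.continuous.aestronglyMeasurable C
    (Filter.Eventually.of_forall fun x => hC x (mem_univ x))

/-- The Hilbert space `L²(𝕋ⁿ)`. -/
abbrev TorusL2 (n : ℕ) : Type := Lp ℝ 2 (volume : Measure (UnitAddTorus (Fin n)))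

/-- A Lipschitz function as an element of `L²(𝕋ⁿ)`. -/
def IsTorusLipschitz.toL2 {n : ℕ} {ψ : UnitAddTorus (Fin n) → ℝ}
    (h : IsTorusLipschitz ψ) : TorusL2 n :=
  h.memLp.toLp ψ

/-! ### The anisotropic total variation energy -/

/-- `φ ∈ C^∞(𝕋ⁿ)`: the periodic lift of `φ` to `ℝⁿ` is smooth. -/
def IsTorusSmooth {n : ℕ} (φ : UnitAddTorus (Fin n) → ℝ) : Prop :=
  ContDiff ℝ ∞ fun p : EuclideanSpace ℝ (Fin n) => φ (torusProj p)

/-- The gradient of `φ`, the vector of the partial derivatives. -/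
def torusGrad {n : ℕ} (φ : UnitAddTorus (Fin n) → ℝ) (x : UnitAddTorus (Fin n)) :
    EuclideanSpace ℝ (Fin n) :=
  WithLp.toLp 2 fun i => deriv (fun t : ℝ => φ (x + Pi.single i (t : UnitAddCircle))) 0

/-- A finite `ℝⁿ`-valued Borel measure on the torus. -/
abbrev TorusVectorMeasure (n : ℕ) : Type :=
  VectorMeasure (UnitAddTorus (Fin n)) (EuclideanSpace ℝ (Fin n))

/-- `μ` is the distributional gradient `Du`: `∫ u ∇φ dx = - ∫ φ dμ` for all `φ ∈ C^∞(𝕋ⁿ)`. -/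
def IsDistribGradient {n : ℕ} (u : UnitAddTorus (Fin n) → ℝ) (μ : TorusVectorMeasure n) : Prop :=
  ∀ φ : UnitAddTorus (Fin n) → ℝ, IsTorusSmooth φ →
    ∫ x, u x • torusGrad φ x = -(∫ᵛ x, φ x ∂•μ)

/-- The `i`-th component of a vector measure. -/
def TorusVectorMeasure.component {n : ℕ} (μ : TorusVectorMeasure n) (i : Fin n) :
    SignedMeasure (UnitAddTorus (Fin n)) :=
  μ.mapRange ((EuclideanSpace.proj i : EuclideanSpace ℝ (Fin n) →L[ℝ] ℝ) : _ →+ ℝ)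
    (EuclideanSpace.proj i : EuclideanSpace ℝ (Fin n) →L[ℝ] ℝ).continuous

/-- The (vector-valued) Radon-Nikodym density of the part of `μ` that is absolutely continuous
with respect to `ν`, computed componentwise. -/
def TorusVectorMeasure.density {n : ℕ} (μ : TorusVectorMeasure n)
    (ν : Measure (UnitAddTorus (Fin n))) (x : UnitAddTorus (Fin n)) : EuclideanSpace ℝ (Fin n) :=
  WithLp.toLp 2 fun i => (μ.component i).rnDeriv ν x

/-- The part of `μ` that is singular with respect to the Lebesgue measure. -/
def TorusVectorMeasure.singular {n : ℕ} (μ : TorusVectorMeasure n) : TorusVectorMeasure n :=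
  μ - (volume : Measure (UnitAddTorus (Fin n))).withDensityᵥ (μ.density volume)

/-- The total mass of the measure
`W(Du) = W(∇u) dx + W(D^s u / |D^s u|) |D^s u|`, where `∇u dx` and `D^s u` are the absolutely
continuous and the singular part of `Du = μ`, and `|D^s u|` is the total variation of `D^s u`. -/
def anisotropicMass {n : ℕ} (W : EuclideanSpace ℝ (Fin n) → ℝ) (μ : TorusVectorMeasure n) :
    ℝ≥0∞ :=
  (∫⁻ x, ENNReal.ofReal (W (μ.density volume x))) +
    ∫⁻ x, ENNReal.ofReal (W (μ.singular.density μ.singular.variation x)) ∂μ.singular.variation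

/-- The energy `E(u) = ∫ W(∇u)` for `u ∈ L²(𝕋ⁿ) ∩ BV(𝕋ⁿ)` and `E(u) = +∞` for
`u ∈ L²(𝕋ⁿ) ∖ BV(𝕋ⁿ)`. The distributional gradient `Du` is unique if it exists, so that the infimum
is over at most one measure; it is `+∞` if there is none. -/
def tvEnergy {n : ℕ} (W : EuclideanSpace ℝ (Fin n) → ℝ) (u : TorusL2 n) : EReal :=
  ((⨅ (μ : TorusVectorMeasure n) (_ : IsDistribGradient u μ), anisotropicMass W μ : ℝ≥0∞) : EReal)

/-! ### Pairs of sets -/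

/-- The neighbourhood `𝒰^ρ(A)`: dilation for `ρ > 0`, erosion for `ρ < 0`. -/
def torusNbd {n : ℕ} (ρ : ℝ) (A : Set (UnitAddTorus (Fin n))) : Set (UnitAddTorus (Fin n)) :=
  if 0 < ρ then A + torusClosedBall 0 ρ
  else if ρ = 0 then A
  else {x | torusClosedBall x |ρ| ⊆ A}

/-- An ordered pair `(A₋, A₊)` of disjoint subsets of the torus. -/
@[ext]
structure TorusPair (n : ℕ) where
  neg : Set (UnitAddTorus (Fin n))
  pos : Set (UnitAddTorus (Fin n))
  disjoint : Disjoint neg pos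

/-- `(A₋, A₊) ⪯ (B₋, B₊)` means `A₊ ⊆ B₊` and `B₋ ⊆ A₋`. -/
instance {n : ℕ} : PartialOrder (TorusPair n) where
  le A B := A.pos ⊆ B.pos ∧ B.neg ⊆ A.neg
  le_refl _ := ⟨Subset.rfl, Subset.rfl⟩
  le_trans _ _ _ h k := ⟨h.1.trans k.1, k.2.trans h.2⟩
  le_antisymm _ _ h k := TorusPair.ext (k.2.antisymm h.2) (h.1.antisymm k.1)

theorem torusNbd_disjoint {n : ℕ} {A B : Set (UnitAddTorus (Fin n))} (h : Disjoint A B) {ρ : ℝ}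
    (hρ : 0 < ρ) : Disjoint (torusNbd (-ρ) A) (torusNbd ρ B) := by
  have h1 : ¬ (0 < -ρ) := by linarith
  have h2 : ¬ (-ρ = 0) := by linarith
  simp only [torusNbd, if_pos hρ, if_neg h1, if_neg h2, abs_neg, abs_of_pos hρ]
  rw [Set.disjoint_left]
  rintro _ hx ⟨b, hb, c, hc, rfl⟩
  refine Set.disjoint_left.1 h (hx ?_) hb
  simp only [torusClosedBall, mem_ofPred_eq, torusNorm_eq] at hc ⊢
  simpa using hc

/-- The neighbourhood `𝒰^ρ(A₋, A₊) = (𝒰^{-ρ}(A₋), 𝒰^ρ(A₊))` of a pair. -/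
def TorusPair.nbd {n : ℕ} (ρ : ℝ) (A : TorusPair n) : TorusPair n where
  neg := torusNbd (-ρ) A.neg
  pos := torusNbd ρ A.pos
  disjoint := by
    rcases lt_trichotomy ρ 0 with hρ | rfl | hρ
    · have := torusNbd_disjoint A.disjoint.symm (neg_pos.2 hρ)
      rw [neg_neg] at this
      exact this.symm
    · simpa [torusNbd] using A.disjoint
    · exact torusNbd_disjoint A.disjoint hρ

/-- A pair is open if both sets are open. -/
def TorusPair.IsOpen {n : ℕ} (A : TorusPair n) : Prop :=
  _root_.IsOpen A.neg ∧ _root_.IsOpen A.pos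

/-- `ψ` is a support function of the pair `(A₋, A₊)`. -/
structure IsSupportFunction {n : ℕ} (A : TorusPair n) (ψ : UnitAddTorus (Fin n) → ℝ) : Prop where
  lipschitz : IsTorusLipschitz ψ
  pos : ∀ x ∈ A.pos, 0 < ψ x
  zero : ∀ x ∈ (A.neg ∪ A.pos)ᶜ, ψ x = 0
  neg : ∀ x ∈ A.neg, ψ x < 0

end

/-! The energy enters through four properties on `L²`: it is subadditive, positively
one-homogeneous, lower semicontinuous and submodular, `E(u ⊓ v) + E(u ⊔ v) ≤ E(u) + E(v)`.

Homogeneity turns `v ∈ ∂E(u)` into `v ∈ ∂E(0)` together with `E(u) = ⟨u, v⟩`. By submodularity this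
identity splits into one for `u ⊔ 0` and one for `u ⊓ 0`, so `∂E` does not change when these two
parts are multiplied by different positive constants (`IsSublinearLsc.subdifferential_pos_add_neg`).
Strict ordering of the pairs and compactness of the torus give constants for which the rescaled `ψH`
lies above `ψG` everywhere (`exists_support_le`), and its minimal section is still that of `ψH`.

For ordered functions, submodularity makes the resolvents of `∂E` order preserving
(`resolvent_mono`). Where the two functions agree, this orders the Yosida approximations the
opposite way. These converge in `L²` to the minimal sections, and almost everywhere along a
subsequence, which gives the comparison (`minimalSection_comparison`).

The properties of the energy rest on duality. `W` is a supremum of linear functionals `⟨z, ·⟩`, so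
the mass of `W(Du)` is the least mass of a finite measure `m` with `⟨z, Du⟩ ≤ m` for all these `z`.
Lower semicontinuity is then weak compactness of finite measures (`torusTV_le_of_mem_closure`).
Submodularity follows by mollification, a smooth minimum and convexity of `W`
(`isSubmodular_torusTV`). -/

noncomputable section

/-! ### Resolvents and Yosida approximations of sublinear functionals on a Hilbert space. -/

section AbstractResolvent

variable {H : Type*} [NormedAddCommGroup H] [InnerProductSpace ℝ H]

/-- A sublinear (subadditive, positively homogeneous) lower semicontinuous functional. -/
structure IsSublinearLsc (F : H → ℝ≥0∞) : Prop where
  zero : F 0 = 0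
  add : ∀ u v, F (u + v) ≤ F u + F v
  smul : ∀ c : ℝ, 0 < c → ∀ u, F (c • u) ≤ ENNReal.ofReal c * F u
  lsc : LowerSemicontinuous F

/-- Testing with `h = -u` compares `F u` with `F 0 = 0`. -/
theorem ne_top_of_mem_subdifferential {F : H → ℝ≥0∞} (h0 : F 0 = 0) {u v : H}
    (h : v ∈ subdifferential (fun x => (F x : EReal)) u) : F u ≠ ⊤ := by
  intro hu
  have := h (-u)
  simp [hu, h0] at this

theorem mem_subdifferential_iff {F : H → ℝ≥0∞} {u v : H} (hu : F u ≠ ⊤) :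
    v ∈ subdifferential (fun x => (F x : EReal)) u ↔
      ∀ w, F w ≠ ⊤ → (F u).toReal + inner ℝ (w - u) v ≤ (F w).toReal := by
  have key : ∀ w, F w ≠ ⊤ → ((F u : EReal) + ((inner ℝ (w - u) v : ℝ) : EReal) ≤ (F w : EReal) ↔
      (F u).toReal + inner ℝ (w - u) v ≤ (F w).toReal) := by
    intro w hw
    rw [← EReal.coe_toReal (x := (F u : EReal)) (by simpa using hu) (by simp),
      ← EReal.coe_toReal (x := (F w : EReal)) (by simpa using hw) (by simp),
      ← EReal.coe_add, EReal.coe_le_coe_iff]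
    simp
  constructor
  · intro h w hw
    have := h (w - u)
    simp only [add_sub_cancel] at this
    exact (key w hw).1 this
  · intro h k
    by_cases hk : F (u + k) = ⊤
    · simp [hk]
    · have := (key (u + k) hk).2 (h _ hk)
      simpa using this

theorem inner_sub_nonneg_of_mem_subdifferential {F : H → ℝ≥0∞} (h0 : F 0 = 0) {u₁ u₂ v₁ v₂ : H}
    (h₁ : v₁ ∈ subdifferential (fun x => (F x : EReal)) u₁)
    (h₂ : v₂ ∈ subdifferential (fun x => (F x : EReal)) u₂) :
    0 ≤ inner ℝ (v₁ - v₂) (u₁ - u₂) := by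
  have e₁ := ne_top_of_mem_subdifferential h0 h₁
  have e₂ := ne_top_of_mem_subdifferential h0 h₂
  have a := (mem_subdifferential_iff e₁).1 h₁ u₂ e₂
  have b := (mem_subdifferential_iff e₂).1 h₂ u₁ e₁
  simp only [inner_sub_left, inner_sub_right] at a b ⊢
  rw [real_inner_comm u₁ v₁, real_inner_comm u₂ v₁, real_inner_comm u₁ v₂, real_inner_comm u₂ v₂]
  linarith

variable {F : H → ℝ≥0∞}

theorem IsSublinearLsc.add_smul_le (hF : IsSublinearLsc F) {s t : ℝ} (hs : 0 < s) (ht : 0 < t)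
    {u v : H} (hu : F u ≠ ⊤) (hv : F v ≠ ⊤) :
    F (s • u + t • v) ≠ ⊤ ∧
      (F (s • u + t • v)).toReal ≤ s * (F u).toReal + t * (F v).toReal := by
  have h : F (s • u + t • v) ≤ ENNReal.ofReal s * F u + ENNReal.ofReal t * F v :=
    (hF.add _ _).trans (add_le_add (hF.smul s hs u) (hF.smul t ht v))
  have hfin : ENNReal.ofReal s * F u + ENNReal.ofReal t * F v ≠ ⊤ := by finiteness
  refine ⟨ne_top_of_le_ne_top hfin h, (ENNReal.toReal_mono hfin h).trans_eq ?_⟩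
  rw [ENNReal.toReal_add (by finiteness) (by finiteness), ENNReal.toReal_mul, ENNReal.toReal_mul,
    ENNReal.toReal_ofReal hs.le, ENNReal.toReal_ofReal ht.le]

/-- The proximal functional `w ↦ |w - u|² / 2 + a⁻¹ F w` attains its minimum (stated after
multiplication by `2 a`). -/
theorem IsSublinearLsc.exists_minimizer [CompleteSpace H] (hF : IsSublinearLsc F) {a : ℝ}
    (ha : 0 < a) (u : H) :
    ∃ w, F w ≠ ⊤ ∧ ∀ v, F v ≠ ⊤ →
      ‖w - u‖ ^ 2 + 2 * a * (F w).toReal ≤ ‖v - u‖ ^ 2 + 2 * a * (F v).toReal := by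
  set J : H → ℝ := fun w => ‖w - u‖ ^ 2 + 2 * a * (F w).toReal with hJ
  have hJ0 : ∀ w, 0 ≤ J w := fun w => by positivity
  set S : Set ℝ := J '' {w | F w ≠ ⊤} with hS
  have hSne : S.Nonempty := ⟨J 0, 0, by simp [hF.zero], rfl⟩
  have hSb : BddBelow S := ⟨0, by rintro _ ⟨w, -, rfl⟩; exact hJ0 w⟩
  set c := sInf S with hc
  have hcle : ∀ w, F w ≠ ⊤ → c ≤ J w := fun w hw => csInf_le hSb ⟨w, hw, rfl⟩
  have hex : ∀ k : ℕ, ∃ w, F w ≠ ⊤ ∧ J w < c + 1 / ((k : ℝ) + 1) := by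
    intro k
    obtain ⟨_, ⟨w, hw, rfl⟩, h⟩ := exists_lt_of_csInf_lt hSne
      (show sInf S < c + 1 / ((k : ℝ) + 1) by rw [← hc]; linarith [Nat.one_div_pos_of_nat (α := ℝ) (n := k)])
    exact ⟨w, hw, h⟩
  choose x hxfin hx using hex
  -- Strong convexity: the parallelogram law, with the midpoint tested against the infimum `c`,
  -- makes minimizing sequences Cauchy.
  have hpar : ∀ v w, F v ≠ ⊤ → F w ≠ ⊤ → ‖v - w‖ ^ 2 ≤ 2 * (J v - c) + 2 * (J w - c) := by
    intro v w hv hw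
    obtain ⟨h1, h2⟩ := hF.add_smul_le (s := 1 / 2) (t := 1 / 2) (by norm_num) (by norm_num) hv hw
    have h3 := hcle _ h1
    have h4 := parallelogram_law_with_norm ℝ (v - u) (w - u)
    have e1 : v - u - (w - u) = v - w := by abel
    have e2 : v - u + (w - u) = (2 : ℝ) • ((1 / 2 : ℝ) • v + (1 / 2 : ℝ) • w - u) := by
      module
    rw [e1, e2, norm_smul, Real.norm_ofNat] at h4
    simp only [hJ] at h3 ⊢
    nlinarith [mul_le_mul_of_nonneg_left h2 ha.le]
  have hcauchy : CauchySeq x := by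
    rw [Metric.cauchySeq_iff']
    intro ε hε
    obtain ⟨N, hN⟩ := exists_nat_one_div_lt (show 0 < ε ^ 2 / 4 by positivity)
    refine ⟨N, fun k hk => ?_⟩
    have h1 := hpar (x k) (x N) (hxfin k) (hxfin N)
    have h2 := hx k
    have h3 := hx N
    have h4 : 1 / ((k : ℝ) + 1) ≤ 1 / ((N : ℝ) + 1) := Nat.one_div_le_one_div hk
    rw [dist_eq_norm]
    exact lt_of_pow_lt_pow_left₀ 2 hε.le (by linarith)
  obtain ⟨w, hw⟩ := cauchySeq_tendsto_of_complete hcauchy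
  have hn : Filter.Tendsto (fun k => ‖x k - u‖ ^ 2) Filter.atTop (nhds (‖w - u‖ ^ 2)) :=
    ((hw.sub_const u).norm).pow 2
  -- Along the minimizing sequence `F` is eventually below this bound, and sublevel sets of `F` are
  -- closed.
  have hFw : ∀ ε : ℝ, 0 < ε → F w ≤ ENNReal.ofReal ((c + ε - ‖w - u‖ ^ 2) / (2 * a)) := by
    intro ε hε
    have hcl := lowerSemicontinuous_iff_isClosed_preimage.1 hF.lsc
      (ENNReal.ofReal ((c + ε - ‖w - u‖ ^ 2) / (2 * a)))
    refine hcl.mem_of_tendsto hw ?_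
    have e1 : ∀ᶠ k in Filter.atTop, ‖w - u‖ ^ 2 - ε / 2 < ‖x k - u‖ ^ 2 :=
      hn.eventually_const_lt (by linarith)
    have e2 : ∀ᶠ k : ℕ in Filter.atTop, 1 / ((k : ℝ) + 1) < ε / 2 :=
      tendsto_one_div_add_atTop_nhds_zero_nat.eventually_lt_const (by linarith)
    filter_upwards [e1, e2] with k h1 h2
    simp only [mem_preimage, mem_Iic]
    rw [ENNReal.le_ofReal_iff_toReal_le (hxfin k)
      (by
        have := hx k
        simp only [hJ] at this
        have h3 : 0 ≤ 2 * a * (F (x k)).toReal := by positivity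
        apply div_nonneg _ (by positivity)
        linarith)]
    rw [le_div_iff₀ (by positivity)]
    have := hx k
    simp only [hJ] at this
    linarith
  have hwfin : F w ≠ ⊤ := ne_top_of_le_ne_top ENNReal.ofReal_ne_top (hFw 1 one_pos)
  refine ⟨w, hwfin, fun v hv => ?_⟩
  refine le_trans (le_of_forall_pos_le_add fun ε hε => ?_) (hcle v hv)
  by_cases hneg : 0 ≤ (c + ε - ‖w - u‖ ^ 2) / (2 * a)
  · have := ENNReal.toReal_le_of_le_ofReal hneg (hFw ε hε)
    rw [le_div_iff₀ (by positivity)] at this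
    linarith
  -- Here `ENNReal.ofReal` truncates the bound to `0`, so the estimate has to come from `‖w - u‖ ^ 2
  -- ≤ c` instead.
  · have h0 : F w = 0 := by
      have := hFw ε hε
      rwa [ENNReal.ofReal_of_nonpos (by linarith), nonpos_iff_eq_zero] at this
    rw [h0]
    have h1 : ‖w - u‖ ^ 2 ≤ c := by
      refine le_of_tendsto_of_tendsto' hn (g := fun k : ℕ => c + 1 / ((k : ℝ) + 1)) ?_ ?_
      · simpa using (tendsto_const_nhds (x := c)).add
          (tendsto_one_div_add_atTop_nhds_zero_nat (𝕜 := ℝ))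
      · intro k
        have := hx k
        simp only [hJ] at this
        have h3 : 0 ≤ 2 * a * (F (x k)).toReal := by positivity
        linarith
    simp only [ENNReal.toReal_zero]
    linarith

/-- This is the Euler-Lagrange inequality of the proximal minimizer: compare `w` with `(1 - t) • w +
t • v`, divide by `t` and let `t` tend to `0`. -/
theorem IsSublinearLsc.exists_resolvent [CompleteSpace H] (hF : IsSublinearLsc F) {a : ℝ}
    (ha : 0 < a) (u : H) :
    ∃ w, a⁻¹ • (u - w) ∈ subdifferential (fun x => (F x : EReal)) w := by
  obtain ⟨w, hw, hmin⟩ := hF.exists_minimizer ha u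
  refine ⟨w, (mem_subdifferential_iff hw).2 fun v hv => ?_⟩
  have key : ∀ t : ℝ, 0 < t → t < 1 →
      0 ≤ 2 * inner ℝ (v - w) (w - u) + 2 * a * ((F v).toReal - (F w).toReal) + t * ‖v - w‖ ^ 2 := by
    intro t ht ht1
    obtain ⟨h1, h2⟩ := hF.add_smul_le (s := 1 - t) (t := t) (by linarith) ht hw hv
    have h3 := hmin _ h1
    have e : (1 - t) • w + t • v - u = (w - u) + t • (v - w) := by module
    rw [e, norm_add_sq_real, inner_smul_right, norm_smul, Real.norm_of_nonneg ht.le,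
      real_inner_comm] at h3
    have h4 := mul_le_mul_of_nonneg_left h2 ha.le
    have h5 : 0 ≤ t * (2 * inner ℝ (v - w) (w - u) + 2 * a * ((F v).toReal - (F w).toReal)
        + t * ‖v - w‖ ^ 2) := by nlinarith
    exact nonneg_of_mul_nonneg_right h5 ht
  have hlim : 0 ≤ 2 * inner ℝ (v - w) (w - u) + 2 * a * ((F v).toReal - (F w).toReal) := by
    have ht : Filter.Tendsto (fun t : ℝ => 2 * inner ℝ (v - w) (w - u)
        + 2 * a * ((F v).toReal - (F w).toReal) + t * ‖v - w‖ ^ 2) (nhdsWithin 0 (Ioi 0))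
        (nhds (2 * inner ℝ (v - w) (w - u) + 2 * a * ((F v).toReal - (F w).toReal)
          + 0 * ‖v - w‖ ^ 2)) :=
      ((by fun_prop : Continuous fun t : ℝ => 2 * inner ℝ (v - w) (w - u)
        + 2 * a * ((F v).toReal - (F w).toReal) + t * ‖v - w‖ ^ 2).tendsto 0).mono_left
        nhdsWithin_le_nhds
    have := ge_of_tendsto ht (b := 0) (by
      filter_upwards [Ioo_mem_nhdsGT (show (0 : ℝ) < 1 by norm_num)] with t ht
      exact key t ht.1 ht.2)
    simpa using this
  have e : inner ℝ (v - w) (u - w) = - inner ℝ (v - w) (w - u) := by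
    rw [← inner_neg_right, neg_sub]
  rw [inner_smul_right, e]
  have : (F w).toReal + a⁻¹ * -inner ℝ (v - w) (w - u) - (F v).toReal =
      -a⁻¹ / 2 * (2 * inner ℝ (v - w) (w - u) + 2 * a * ((F v).toReal - (F w).toReal)) := by
    field_simp; ring
  have h6 : 0 ≤ a⁻¹ / 2 * (2 * inner ℝ (v - w) (w - u) + 2 * a * ((F v).toReal - (F w).toReal)) := by
    positivity
  linarith

/-- The Yosida approximations converge to the minimal section. -/
theorem tendsto_yosida_minimalSection [CompleteSpace H] (h0 : F 0 = 0) {u : H}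
    (hu : u ∈ subdifferentialDom (fun x => (F x : EReal))) {f : ℕ → H}
    (hf : ∀ k : ℕ, f k ∈ subdifferential (fun x => (F x : EReal)) (u - ((k : ℝ) + 1)⁻¹ • f k)) :
    Filter.Tendsto f Filter.atTop
      (nhds (minimalSection (fun x => (F x : EReal)) u hu)) := by
  obtain ⟨⟨hg, hgmin⟩, huniq⟩ := (existsUnique_minimalSection _ u hu).choose_spec
  change Filter.Tendsto f Filter.atTop (nhds (existsUnique_minimalSection _ u hu).choose)
  set g := (existsUnique_minimalSection _ u hu).choose with hgdef
  -- Monotonicity between `u` and the resolvent point gives `‖f k‖ ^ 2 ≤ ⟨g, f k⟩`.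
  have hbound : ∀ k, ‖f k‖ ≤ ‖g‖ := by
    intro k
    have h := inner_sub_nonneg_of_mem_subdifferential h0 hg (hf k)
    rw [sub_sub_cancel, inner_smul_right] at h
    have h1 := nonneg_of_mul_nonneg_right h (by positivity : (0 : ℝ) < ((k : ℝ) + 1)⁻¹)
    rw [inner_sub_left, real_inner_self_eq_norm_sq] at h1
    have h2 := real_inner_le_norm g (f k)
    by_contra! hlt
    nlinarith [norm_nonneg g]
  -- Monotonicity between two resolvent points with steps `b ≤ a` yields `h4`. The squared norms are
  -- therefore nondecreasing and bounded, and control the distances, so `f` is Cauchy.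
  have hmono : ∀ j k : ℕ, j ≤ k → ‖f k - f j‖ ^ 2 ≤ ‖f k‖ ^ 2 - ‖f j‖ ^ 2 := by
    intro j k hjk
    set a : ℝ := ((j : ℝ) + 1)⁻¹ with ha
    set b : ℝ := ((k : ℝ) + 1)⁻¹ with hb
    have ha0 : 0 < a := by positivity
    have hb0 : 0 < b := by positivity
    have hba : b ≤ a := by
      rw [ha, hb]; gcongr
    have h := inner_sub_nonneg_of_mem_subdifferential h0 (hf j) (hf k)
    have e : u - a • f j - (u - b • f k) = b • f k - a • f j := by abel
    rw [e] at h
    simp only [inner_sub_left, inner_sub_right, inner_smul_right, real_inner_self_eq_norm_sq] at h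
    rw [real_inner_comm (f j) (f k)] at h
    have h2 : ‖f k - f j‖ ^ 2 = ‖f k‖ ^ 2 - 2 * inner ℝ (f j) (f k) + ‖f j‖ ^ 2 := by
      rw [norm_sub_sq_real, real_inner_comm]
    have h3 : 0 ≤ ‖f k - f j‖ ^ 2 := sq_nonneg _
    have h4 : (a + b) * ‖f k - f j‖ ^ 2 ≤ (a - b) * (‖f k‖ ^ 2 - ‖f j‖ ^ 2) := by
      rw [h2]; linarith
    rcases hba.eq_or_lt with heq | hlt
    · have : ‖f k - f j‖ ^ 2 ≤ 0 := by
        rw [heq, sub_self, zero_mul] at h4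
        by_contra! hlt
        nlinarith
      have h5 : f k = f j := by
        have := (pow_eq_zero_iff two_ne_zero).1 (le_antisymm this h3)
        exact sub_eq_zero.1 (norm_eq_zero.1 this)
      simp [h5]
    · have h5 : 0 ≤ ‖f k‖ ^ 2 - ‖f j‖ ^ 2 := by
        by_contra! hneg
        nlinarith
      nlinarith
  have hcauchy : CauchySeq f := by
    have hm : Monotone fun k => ‖f k‖ ^ 2 := fun j k hjk => by
      have := hmono j k hjk
      dsimp only
      linarith [sq_nonneg ‖f k - f j‖]
    have hbdd : BddAbove (range fun k => ‖f k‖ ^ 2) :=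
      ⟨‖g‖ ^ 2, by rintro _ ⟨k, rfl⟩; exact pow_le_pow_left₀ (norm_nonneg _) (hbound k) 2⟩
    have hc := (tendsto_atTop_ciSup hm hbdd).cauchySeq
    rw [Metric.cauchySeq_iff'] at hc ⊢
    intro ε hε
    obtain ⟨N, hN⟩ := hc (ε ^ 2) (by positivity)
    refine ⟨N, fun k hk => ?_⟩
    have h1 := hN k hk
    rw [Real.dist_eq] at h1
    rw [dist_eq_norm]
    exact lt_of_pow_lt_pow_left₀ 2 hε.le ((hmono N k hk).trans_lt ((le_abs_self _).trans_lt h1))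
  obtain ⟨l, hl⟩ := cauchySeq_tendsto_of_complete hcauchy
  have hufin := ne_top_of_mem_subdifferential h0 hg
  have hstep : Filter.Tendsto (fun k : ℕ => u - ((k : ℝ) + 1)⁻¹ • f k) Filter.atTop (nhds u) := by
    have h1 := (tendsto_one_div_add_atTop_nhds_zero_nat (𝕜 := ℝ)).smul hl
    simp only [one_div, zero_smul] at h1
    simpa using tendsto_const_nhds.sub h1
  have hlmem : l ∈ subdifferential (fun x => (F x : EReal)) u := by
    refine (mem_subdifferential_iff hufin).2 fun w hw => ?_
    -- The subgradient `g` at `u` bounds `F` from below at the resolvent points, so the limit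
    -- requires no semicontinuity of `F`.
    have hk : ∀ k : ℕ, (F u).toReal + inner ℝ (u - ((k : ℝ) + 1)⁻¹ • f k - u) g
        + inner ℝ (w - (u - ((k : ℝ) + 1)⁻¹ • f k)) (f k) ≤ (F w).toReal := by
      intro k
      have hkfin := ne_top_of_mem_subdifferential h0 (hf k)
      have h1 := (mem_subdifferential_iff hufin).1 hg _ hkfin
      have h2 := (mem_subdifferential_iff hkfin).1 (hf k) w hw
      linarith
    have ht := ((tendsto_const_nhds (x := (F u).toReal)).add
      ((hstep.sub_const u).inner (tendsto_const_nhds (x := g)) (𝕜 := ℝ))).add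
      (((tendsto_const_nhds (x := w)).sub hstep).inner hl (𝕜 := ℝ))
    have := le_of_tendsto' ht hk
    simpa using this
  have : l = g := by
    refine huniq l ⟨hlmem, fun w hw => ?_⟩
    refine le_trans ?_ (hgmin w hw)
    exact le_of_tendsto' hl.norm hbound
  rwa [this] at hl

/-- For a sublinear functional, `v ∈ ∂F(u)` iff `v ∈ ∂F(0)` and `F(u) = ⟨u, v⟩`. -/
theorem IsSublinearLsc.mem_subdifferential_iff_inner (hF : IsSublinearLsc F) {u v : H}
    (hu : F u ≠ ⊤) :
    v ∈ subdifferential (fun x => (F x : EReal)) u ↔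
      (∀ w, F w ≠ ⊤ → inner ℝ w v ≤ (F w).toReal) ∧ (F u).toReal ≤ inner ℝ u v := by
  rw [mem_subdifferential_iff hu]
  constructor
  · intro h
    refine ⟨fun w hw => ?_, ?_⟩
    · obtain ⟨h1, h2⟩ := hF.add_smul_le one_pos one_pos hu hw
      rw [one_smul, one_smul] at h1 h2
      have := h _ h1
      rw [add_sub_cancel_left] at this
      linarith
    · have := h 0 (by simp [hF.zero])
      rw [zero_sub, inner_neg_left, hF.zero, ENNReal.toReal_zero] at this
      linarith
  · rintro ⟨h1, h2⟩ w hw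
    have := h1 w hw
    rw [inner_sub_left]
    linarith

end AbstractResolvent

/-! ### Submodularity, order and rescaling in `L²`. -/

section LatticeResolvent

variable {α : Type*} [MeasurableSpace α] {μ : Measure α}

/-- Submodularity of a functional on a lattice. -/
def IsSubmodular {L : Type*} [Lattice L] (F : L → ℝ≥0∞) : Prop :=
  ∀ u v, F (u ⊓ v) + F (u ⊔ v) ≤ F u + F v

theorem L2_inner_nonneg {f g : Lp ℝ 2 μ} (hf : 0 ≤ f) (hg : 0 ≤ g) : 0 ≤ inner ℝ f g := by
  rw [L2.inner_def]
  refine integral_nonneg_of_ae ?_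
  filter_upwards [(Lp.coeFn_nonneg f).2 hf, (Lp.coeFn_nonneg g).2 hg] with x h1 h2
  simpa using mul_nonneg h2 h1

/-- `f - f ⊓ g` is the positive part of `f - g`, which is orthogonal to the negative part. -/
theorem L2_inner_sub_inf (f g : Lp ℝ 2 μ) :
    inner ℝ (f - f ⊓ g) (f - g) = ‖f - f ⊓ g‖ ^ 2 := by
  rw [← real_inner_self_eq_norm_sq, L2.inner_def, L2.inner_def]
  refine integral_congr_ae ?_
  filter_upwards [Lp.coeFn_sub f (f ⊓ g), Lp.coeFn_sub f g, Lp.coeFn_inf f g] with x h1 h2 h3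
  simp only [h1, h2, h3, Pi.sub_apply, Pi.inf_apply, RCLike.inner_apply, conj_trivial]
  rcases le_total (f x) (g x) with h | h
  · simp [inf_eq_left.2 h]
  · simp [inf_eq_right.2 h]

variable {F : Lp ℝ 2 μ → ℝ≥0∞}

/-- The resolvent of the subdifferential of a submodular functional is order preserving. -/
theorem resolvent_mono (h0 : F 0 = 0) (hsub : IsSubmodular F) {a : ℝ} (ha : 0 < a)
    {u₁ u₂ f₁ f₂ : Lp ℝ 2 μ} (hu : u₁ ≤ u₂)
    (h₁ : f₁ ∈ subdifferential (fun x => (F x : EReal)) (u₁ - a • f₁))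
    (h₂ : f₂ ∈ subdifferential (fun x => (F x : EReal)) (u₂ - a • f₂)) :
    u₁ - a • f₁ ≤ u₂ - a • f₂ := by
  have e₁ := ne_top_of_mem_subdifferential h0 h₁
  have e₂ := ne_top_of_mem_subdifferential h0 h₂
  set w₁ := u₁ - a • f₁ with hw₁
  set w₂ := u₂ - a • f₂ with hw₂
  -- `d` is the positive part of `w₁ - w₂`, and the aim is `d = 0`. The competitors are `w₁ ⊓ w₂ =
  -- w₁ - d` for `f₁` and `w₁ ⊔ w₂ = w₂ + d` for `f₂`; submodularity cancels the energies when the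
  -- two inequalities are added.
  set d := w₁ - w₁ ⊓ w₂ with hd
  have hd2 : w₁ ⊔ w₂ - w₂ = d := by
    rw [hd, sub_eq_sub_iff_add_eq_add, add_comm, inf_add_sup]
  have hs := hsub w₁ w₂
  have hfin : F (w₁ ⊓ w₂) + F (w₁ ⊔ w₂) ≠ ⊤ := ne_top_of_le_ne_top (by finiteness) hs
  obtain ⟨hi, hj⟩ := ENNReal.add_ne_top.1 hfin
  have hs' := ENNReal.toReal_mono (by finiteness) hs
  rw [ENNReal.toReal_add hi hj, ENNReal.toReal_add e₁ e₂] at hs'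
  have a1 := (mem_subdifferential_iff e₁).1 h₁ _ hi
  have a2 := (mem_subdifferential_iff e₂).1 h₂ _ hj
  rw [hd2] at a2
  rw [← neg_sub, ← hd, inner_neg_left] at a1
  have h3 : inner ℝ d (f₂ - f₁) ≤ 0 := by rw [inner_sub_right]; linarith
  have h4 : a • (f₂ - f₁) = (u₂ - u₁) + (w₁ - w₂) := by
    rw [hw₁, hw₂, smul_sub]; abel
  have h5 : a * inner ℝ d (f₂ - f₁) = inner ℝ d (u₂ - u₁) + ‖d‖ ^ 2 := by
    rw [← inner_smul_right, h4, inner_add_right, hd, L2_inner_sub_inf]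
  have h6 : 0 ≤ inner ℝ d (u₂ - u₁) :=
    L2_inner_nonneg (sub_nonneg.2 inf_le_left) (sub_nonneg.2 hu)
  have h7 : a * inner ℝ d (f₂ - f₁) ≤ 0 := mul_nonpos_of_nonneg_of_nonpos ha.le h3
  have h8 : d = 0 := by
    have : ‖d‖ ^ 2 = 0 := le_antisymm (by linarith) (sq_nonneg _)
    exact norm_eq_zero.1 ((pow_eq_zero_iff two_ne_zero).1 this)
  exact inf_eq_left.1 (sub_eq_zero.1 h8).symm

/-- Comparison of minimal sections at ordered functions, on a set where the functions agree. -/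
theorem minimalSection_comparison (hF : IsSublinearLsc F) (hsub : IsSubmodular F)
    {u₁ u₂ : Lp ℝ 2 μ} (hu : u₁ ≤ u₂) {D : Set α} (hD : ∀ᵐ x ∂μ, x ∈ D → u₁ x = u₂ x)
    (h₁ : u₁ ∈ subdifferentialDom (fun x => (F x : EReal)))
    (h₂ : u₂ ∈ subdifferentialDom (fun x => (F x : EReal))) :
    ∀ᵐ x ∂μ, x ∈ D → minimalSection (fun x => (F x : EReal)) u₂ h₂ x ≤
      minimalSection (fun x => (F x : EReal)) u₁ h₁ x := by
  have hex : ∀ u : Lp ℝ 2 μ, ∃ f : ℕ → Lp ℝ 2 μ, ∀ k : ℕ,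
      f k ∈ subdifferential (fun x => (F x : EReal)) (u - ((k : ℝ) + 1)⁻¹ • f k) := by
    intro u
    choose w hw using fun k : ℕ =>
      hF.exists_resolvent (show 0 < ((k : ℝ) + 1)⁻¹ by positivity) u
    refine ⟨fun k => (((k : ℝ) + 1)⁻¹)⁻¹ • (u - w k), fun k => ?_⟩
    have hk : ((k : ℝ) + 1)⁻¹ ≠ 0 := by positivity
    have e : u - ((k : ℝ) + 1)⁻¹ • (((k : ℝ) + 1)⁻¹)⁻¹ • (u - w k) = w k := by
      rw [smul_inv_smul₀ hk]; abel
    simpa only [e] using hw k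
  obtain ⟨f, hf⟩ := hex u₁
  obtain ⟨g, hg⟩ := hex u₂
  have tf := tendsto_yosida_minimalSection hF.zero h₁ hf
  have tg := tendsto_yosida_minimalSection hF.zero h₂ hg
  -- Convergence in `L²` implies convergence in measure, hence almost everywhere along a
  -- subsequence.
  obtain ⟨s, hs, hs'⟩ := (tendstoInMeasure_of_tendsto_Lp (tf.sub tg)).exists_seq_tendsto_ae
  have hall : ∀ᵐ x ∂μ, ∀ k, x ∈ D → 0 ≤ (f k - g k) x := by
    rw [ae_all_iff]
    intro k
    -- On `D` the terms `u₁` and `u₂` cancel, so the order of the resolvents becomes the reverse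
    -- order of `f k` and `g k`.
    have hle := resolvent_mono hF.zero hsub (show 0 < ((k : ℝ) + 1)⁻¹ by positivity) hu
      (hf k) (hg k)
    filter_upwards [(Lp.coeFn_le _ _).2 hle, hD, Lp.coeFn_sub (f k) (g k),
      Lp.coeFn_sub u₁ (((k : ℝ) + 1)⁻¹ • f k), Lp.coeFn_sub u₂ (((k : ℝ) + 1)⁻¹ • g k),
      Lp.coeFn_smul ((k : ℝ) + 1)⁻¹ (f k), Lp.coeFn_smul ((k : ℝ) + 1)⁻¹ (g k)]
      with x h1 h2 h3 h4 h5 h6 h7 hx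
    rw [h4, h5] at h1
    simp only [Pi.sub_apply, h6, h7, Pi.smul_apply, smul_eq_mul, h2 hx] at h1
    rw [h3, Pi.sub_apply, sub_nonneg]
    have hk : (0 : ℝ) < ((k : ℝ) + 1)⁻¹ := by positivity
    exact le_of_mul_le_mul_left (by linarith) hk
  filter_upwards [hs', hall, Lp.coeFn_sub (minimalSection (fun x => (F x : EReal)) u₁ h₁)
    (minimalSection (fun x => (F x : EReal)) u₂ h₂)] with x h1 h2 h3 hx
  have := ge_of_tendsto' h1 fun k => h2 (s k) hx
  rw [h3, Pi.sub_apply] at this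
  linarith

/-- Since `v ∈ ∂F(0)`, each of `u ⊔ 0` and `u ⊓ 0` has energy at least its pairing with `v`.
Submodularity with `0` bounds the sum of the energies by `F u = ⟨u, v⟩`, so both are equalities, and
these survive multiplication by `K` and `ε`. -/
theorem IsSublinearLsc.apply_pos_add_neg (hF : IsSublinearLsc F) {u : Lp ℝ 2 μ} {K ε : ℝ}
    (hK : 0 < K) (hε : 0 < ε) {v : Lp ℝ 2 μ} (hsub : IsSubmodular F)
    (hv : v ∈ subdifferential (fun x => (F x : EReal)) u) :
    v ∈ subdifferential (fun x => (F x : EReal)) (K • (u ⊔ 0) + ε • (u ⊓ 0)) := by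
  have hu := ne_top_of_mem_subdifferential hF.zero hv
  obtain ⟨h1, h2⟩ := (hF.mem_subdifferential_iff_inner hu).1 hv
  have hs := hsub u 0
  rw [hF.zero, add_zero] at hs
  have hfin : F (u ⊓ 0) + F (u ⊔ 0) ≠ ⊤ := ne_top_of_le_ne_top hu hs
  obtain ⟨hi, hj⟩ := ENNReal.add_ne_top.1 hfin
  have hs' := ENNReal.toReal_mono hu hs
  rw [ENNReal.toReal_add hi hj] at hs'
  obtain ⟨h3, h4⟩ := hF.add_smul_le hK hε hj hi
  refine (hF.mem_subdifferential_iff_inner h3).2 ⟨h1, h4.trans ?_⟩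
  have h5 := h1 _ hi
  have h6 := h1 _ hj
  have h7 : inner ℝ u v = inner ℝ (u ⊓ 0) v + inner ℝ (u ⊔ 0) v := by
    rw [← inner_add_left, inf_add_sup, add_zero]
  rw [inner_add_left, inner_smul_left, inner_smul_left]
  simp only [conj_trivial]
  have h8 : (F (u ⊔ 0)).toReal ≤ inner ℝ (u ⊔ 0) v := by linarith
  have h9 : (F (u ⊓ 0)).toReal ≤ inner ℝ (u ⊓ 0) v := by linarith
  gcongr

/-- The subdifferential of a sublinear submodular functional does not change when the positive and
the negative part are rescaled. -/
theorem IsSublinearLsc.subdifferential_pos_add_neg (hF : IsSublinearLsc F)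
    (hsub : IsSubmodular F) (u : Lp ℝ 2 μ) {K ε : ℝ} (hK : 0 < K) (hε : 0 < ε) :
    subdifferential (fun x => (F x : EReal)) (K • (u ⊔ 0) + ε • (u ⊓ 0)) =
      subdifferential (fun x => (F x : EReal)) u := by
  refine Subset.antisymm (fun v hv => ?_) fun v hv => hF.apply_pos_add_neg hK hε hsub hv
  have h := hF.apply_pos_add_neg (inv_pos.2 hK) (inv_pos.2 hε) hsub hv
  -- Rescaling keeps the sign of the function, so the inverse constants undo it and the first
  -- inclusion gives the second.
  have e : K⁻¹ • ((K • (u ⊔ 0) + ε • (u ⊓ 0)) ⊔ 0) + ε⁻¹ • ((K • (u ⊔ 0) + ε • (u ⊓ 0)) ⊓ 0) = u := by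
    refine Lp.ext ?_
    filter_upwards [Lp.coeFn_add (K⁻¹ • ((K • (u ⊔ 0) + ε • (u ⊓ 0)) ⊔ 0))
        (ε⁻¹ • ((K • (u ⊔ 0) + ε • (u ⊓ 0)) ⊓ 0)),
      Lp.coeFn_smul K⁻¹ ((K • (u ⊔ 0) + ε • (u ⊓ 0)) ⊔ 0),
      Lp.coeFn_smul ε⁻¹ ((K • (u ⊔ 0) + ε • (u ⊓ 0)) ⊓ 0),
      Lp.coeFn_sup (K • (u ⊔ 0) + ε • (u ⊓ 0)) 0, Lp.coeFn_inf (K • (u ⊔ 0) + ε • (u ⊓ 0)) 0,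
      Lp.coeFn_add (K • (u ⊔ 0)) (ε • (u ⊓ 0)), Lp.coeFn_smul K (u ⊔ 0), Lp.coeFn_smul ε (u ⊓ 0),
      Lp.coeFn_sup u 0, Lp.coeFn_inf u 0, Lp.coeFn_zero ℝ 2 μ] with x a1 a2 a3 a4 a5 a6 a7 a8 a9 b1 b2
    simp only [a1, a2, a3, a4, a5, a6, a7, a8, a9, b1, b2, Pi.add_apply, Pi.smul_apply,
      Pi.sup_apply, Pi.inf_apply, Pi.zero_apply, smul_eq_mul]
    rcases le_total (u x) 0 with h | h
    · have h' : ε * u x ≤ 0 := mul_nonpos_of_nonneg_of_nonpos hε.le h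
      simp [sup_eq_right.2 h, inf_eq_left.2 h, sup_eq_right.2 h', inf_eq_left.2 h', hε.ne']
    · have h' : 0 ≤ K * u x := mul_nonneg hK.le h
      simp [sup_eq_left.2 h, inf_eq_right.2 h, sup_eq_left.2 h', inf_eq_right.2 h', hK.ne']
  rwa [e] at h

theorem minimalSection_congr {H : Type*} [NormedAddCommGroup H] [InnerProductSpace ℝ H]
    [CompleteSpace H] {Φ : H → EReal} {x y : H} (h : subdifferential Φ x = subdifferential Φ y)
    (hx : x ∈ subdifferentialDom Φ) (hy : y ∈ subdifferentialDom Φ) :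
    minimalSection Φ x hx = minimalSection Φ y hy := by
  have h1 := (existsUnique_minimalSection Φ x hx).choose_spec.1
  have h2 := (existsUnique_minimalSection Φ y hy).choose_spec.2
  exact h2 _ ⟨h.subset h1.1, fun w hw => h1.2 w (h.symm.subset hw)⟩

end LatticeResolvent

/-! ### Duality for the integrand `W`. -/

section Gauge

variable {n : ℕ}

/-- A convex, positively one-homogeneous function that is bounded below by `lam |p|`. -/
structure IsGauge (W : EuclideanSpace ℝ (Fin n) → ℝ) (lam : ℝ) : Prop where
  convex : ConvexOn ℝ univ W
  pos : 0 < lam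
  smul : ∀ (p : EuclideanSpace ℝ (Fin n)) (a : ℝ), 0 ≤ a → W (a • p) = a * W p
  lower : ∀ p, lam * ‖p‖ ≤ W p

/-- The set whose support function is `W`. -/
def gaugePolar (W : EuclideanSpace ℝ (Fin n) → ℝ) : Set (EuclideanSpace ℝ (Fin n)) :=
  {z | ∀ p, inner ℝ z p ≤ W p}

variable {W : EuclideanSpace ℝ (Fin n) → ℝ} {lam : ℝ}

theorem IsGauge.nonneg (h : IsGauge W lam) (p : EuclideanSpace ℝ (Fin n)) : 0 ≤ W p :=
  (mul_nonneg h.pos.le (norm_nonneg p)).trans (h.lower p)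

theorem IsGauge.continuous (h : IsGauge W lam) : Continuous W :=
  continuousOn_univ.1 (h.convex.continuousOn isOpen_univ)

theorem IsGauge.mem_polar_of_norm_le (h : IsGauge W lam) {z : EuclideanSpace ℝ (Fin n)}
    (hz : ‖z‖ ≤ lam) : z ∈ gaugePolar W := fun p =>
  (real_inner_le_norm z p).trans ((mul_le_mul_of_nonneg_right hz (norm_nonneg p)).trans (h.lower p))

/-- A convex continuous function is a countable supremum of affine minorants. At the origin these
have constant term at most `0`, and by homogeneity their linear parts alone already lie below `W`.
Countability is what later allows suprema of measurable functions. -/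
theorem IsGauge.exists_seq_polar (h : IsGauge W lam) :
    ∃ z : ℕ → EuclideanSpace ℝ (Fin n), (∀ k, z k ∈ gaugePolar W) ∧
      ∀ p c, c < W p → ∃ k, c < inner ℝ (z k) p := by
  obtain ⟨l, c, hle, hsup⟩ :=
    h.convex.real_univ_sSup_of_nat_affine_eq h.continuous.lowerSemicontinuous
  have hW0 : W 0 = 0 := by simpa using h.smul 0 0 le_rfl
  have hle' : ∀ i p, l i p + c i ≤ W p := fun i p => hle i p
  have hc : ∀ i, c i ≤ 0 := fun i => by simpa [hW0] using hle' i 0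
  have hlin : ∀ i p, l i p ≤ W p := by
    intro i p
    by_contra! hlt
    have hd : 0 < l i p - W p := by linarith
    -- This factor scales `p` so that `l i` exceeds `W` by exactly `1 - c i`, and the affine bound
    -- then reads `1 ≤ 0`.
    have ht : 0 ≤ (1 - c i) / (l i p - W p) := div_nonneg (by linarith [hc i]) hd.le
    have h1 := hle' i (((1 - c i) / (l i p - W p)) • p)
    rw [h.smul _ _ ht, map_smul, smul_eq_mul] at h1
    have h2 : (1 - c i) / (l i p - W p) * (l i p - W p) = 1 - c i := div_mul_cancel₀ _ hd.ne'
    rw [mul_sub] at h2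
    linarith
  refine ⟨fun i => (InnerProductSpace.toDual ℝ (EuclideanSpace ℝ (Fin n))).symm (l i),
    fun i p => by rw [InnerProductSpace.toDual_symm_apply]; exact hlin i p, fun p b hb => ?_⟩
  have hp := congrFun hsup p
  rw [iSup_apply] at hp
  rw [← hp] at hb
  obtain ⟨i, hi⟩ := exists_lt_of_lt_ciSup hb
  refine ⟨i, ?_⟩
  rw [InnerProductSpace.toDual_symm_apply]
  have : l i p + c i > b := hi
  linarith [hc i]

theorem IsGauge.le_of_forall_polar (h : IsGauge W lam) {p : EuclideanSpace ℝ (Fin n)} {c : ℝ}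
    (hp : ∀ z ∈ gaugePolar W, inner ℝ z p ≤ c) : W p ≤ c := by
  obtain ⟨z, hz, hz'⟩ := h.exists_seq_polar
  by_contra! hlt
  obtain ⟨k, hk⟩ := hz' p c hlt
  linarith [hp _ (hz k)]

/-- If all `⟨z, g⟩ ν` with `z` in the polar set are bounded by `m`, so is `W(g) ν`. -/
theorem IsGauge.lintegral_le (h : IsGauge W lam) {α : Type*} [MeasurableSpace α]
    {ν m : Measure α} [IsFiniteMeasure m] {g : α → EuclideanSpace ℝ (Fin n)}
    (hgm : Measurable g) (hg : Integrable g ν)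
    (hle : ∀ z ∈ gaugePolar W, ∀ A, MeasurableSet A → ∫ x in A, inner ℝ z (g x) ∂ν ≤ m.real A) :
    ∫⁻ x, ENNReal.ofReal (W (g x)) ∂ν ≤ m univ := by
  obtain ⟨z, hz, hz'⟩ := h.exists_seq_polar
  set f : ℕ → α → ℝ≥0∞ := fun k x => ENNReal.ofReal (inner ℝ (z k) (g x)) with hf
  have hfm : ∀ k, Measurable fun x => inner ℝ (z k) (g x) := fun k => by fun_prop
  -- `measurableLE ν m` consists of the densities `f` with `f ν ≤ m`. It is stable under finite
  -- suprema, so monotone convergence reaches `W(g)`. The bound is only needed where the integrand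
  -- is nonnegative, hence the set `P`.
  have hmem : ∀ k, f k ∈ Measure.LebesgueDecomposition.measurableLE ν m := by
    intro k
    refine ⟨(hfm k).ennreal_ofReal, fun A hA => ?_⟩
    set P : Set α := {x | 0 ≤ inner ℝ (z k) (g x)} with hP
    have hPm : MeasurableSet P := measurableSet_le measurable_const (hfm k)
    have hint : Integrable (fun x => inner ℝ (z k) (g x)) ν := hg.const_inner (𝕜 := ℝ) (z k)
    calc ∫⁻ x in A, f k x ∂ν = ∫⁻ x in A ∩ P, f k x ∂ν := by
          rw [← lintegral_inter_add_sdiff (μ := ν) (f k) A hPm]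
          have : ∫⁻ x in A \ P, f k x ∂ν = 0 := by
            rw [setLIntegral_eq_zero_iff (hA.diff hPm) (hfm k).ennreal_ofReal]
            refine Filter.Eventually.of_forall fun x hx => ?_
            exact ENNReal.ofReal_of_nonpos (not_le.1 hx.2).le
          rw [this, add_zero]
      _ = ENNReal.ofReal (∫ x in A ∩ P, inner ℝ (z k) (g x) ∂ν) := by
          rw [ofReal_integral_eq_lintegral_ofReal hint.restrict]
          exact (ae_restrict_iff' (hA.inter hPm)).2 (Filter.Eventually.of_forall fun x hx => hx.2)
      _ ≤ ENNReal.ofReal (m.real (A ∩ P)) :=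
          ENNReal.ofReal_le_ofReal (hle _ (hz k) _ (hA.inter hPm))
      _ = m (A ∩ P) := by simp [Measure.real]
      _ ≤ m A := measure_mono inter_subset_left
  have hsup : ∀ x, ENNReal.ofReal (W (g x)) ≤ ⨆ N, (⨆ (k) (_ : k ≤ N), f k) x := by
    intro x
    refine le_of_forall_lt fun c hc => ?_
    have hcfin : c ≠ ⊤ := hc.ne_top
    have hc' : c.toReal < W (g x) := (ENNReal.lt_ofReal_iff_toReal_lt hcfin).1 hc
    obtain ⟨k, hk⟩ := hz' _ _ hc'
    refine lt_of_lt_of_le ((ENNReal.lt_ofReal_iff_toReal_lt hcfin).2 hk) ?_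
    refine le_iSup_of_le k ?_
    simp only [iSup_apply]
    exact le_iSup₂_of_le k le_rfl le_rfl
  calc ∫⁻ x, ENNReal.ofReal (W (g x)) ∂ν ≤ ∫⁻ x, ⨆ N, (⨆ (k) (_ : k ≤ N), f k) x ∂ν :=
        lintegral_mono hsup
    _ = ⨆ N, ∫⁻ x, (⨆ (k) (_ : k ≤ N), f k) x ∂ν := by
        refine lintegral_iSup (fun N =>
          (Measure.LebesgueDecomposition.iSup_mem_measurableLE' f hmem N).1) ?_
        intro N M hNM x
        simp only [iSup_apply]
        exact biSup_mono fun k hk => hk.trans hNM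
    _ ≤ m univ := by
        refine iSup_le fun N => ?_
        have := (Measure.LebesgueDecomposition.iSup_mem_measurableLE' f hmem N).2 univ .univ
        rwa [Measure.restrict_univ] at this

end Gauge

/-! ### Lebesgue and polar decomposition of vector measures. -/

section VectorMeasureDecomposition

variable {n : ℕ}

theorem TorusVectorMeasure.component_apply (μ : TorusVectorMeasure n) (i : Fin n)
    (A : Set (UnitAddTorus (Fin n))) : μ.component i A = μ A i := rfl

/-- In finite dimension the variation is at most the sum of the total variations of the components,
which are finite. -/
instance TorusVectorMeasure.isFiniteMeasure_variation (μ : TorusVectorMeasure n) :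
    IsFiniteMeasure μ.variation := by
  have hle : μ.variation ≤ ∑ i, (μ.component i).totalVariation := by
    refine VectorMeasure.variation_le_of_forall_enorm_le fun A hA => ?_
    calc ‖μ A‖ₑ ≤ ∑ i, ‖μ A i‖ₑ := by
          have h1 : μ A = ∑ i, (μ A i) • EuclideanSpace.basisFun (Fin n) ℝ i := by
            simpa using ((EuclideanSpace.basisFun (Fin n) ℝ).sum_repr (μ A)).symm
          conv_lhs => rw [h1]
          refine (enorm_sum_le _ _).trans (Finset.sum_le_sum fun i _ => ?_)
          rw [enorm_smul, ← ofReal_norm (EuclideanSpace.basisFun (Fin n) ℝ i),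
            OrthonormalBasis.norm_eq_one, ENNReal.ofReal_one, mul_one]
      _ ≤ ∑ i, (μ.component i).totalVariation A := Finset.sum_le_sum fun i _ =>
          (μ.component i).enorm_le_totalVariation A
      _ = (∑ i, (μ.component i).totalVariation) A := by simp
  exact isFiniteMeasure_of_le _ hle

theorem TorusVectorMeasure.measurable_density (μ : TorusVectorMeasure n)
    (ν : Measure (UnitAddTorus (Fin n))) : Measurable (μ.density ν) := by
  refine (WithLp.measurable_toLp 2 _).comp (measurable_pi_lambda _ fun i => ?_)
  exact SignedMeasure.measurable_rnDeriv _ _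

theorem TorusVectorMeasure.integrable_density (μ : TorusVectorMeasure n)
    (ν : Measure (UnitAddTorus (Fin n))) : Integrable (μ.density ν) ν :=
  Integrable.of_eval_piLp fun i => SignedMeasure.integrable_rnDeriv (μ.component i) ν

theorem TorusVectorMeasure.setIntegral_density_apply (μ : TorusVectorMeasure n)
    (ν : Measure (UnitAddTorus (Fin n))) {A : Set (UnitAddTorus (Fin n))} (i : Fin n) :
    (∫ x in A, μ.density ν x ∂ν) i = ∫ x in A, (μ.component i).rnDeriv ν x ∂ν := by
  rw [eval_integral_piLp fun j => (μ.integrable_density ν).restrict.eval_piLp j]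
  rfl

theorem TorusVectorMeasure.singular_apply (μ : TorusVectorMeasure n)
    {A : Set (UnitAddTorus (Fin n))} (hA : MeasurableSet A) :
    μ.singular A = μ A - ∫ x in A, μ.density volume x := by
  rw [TorusVectorMeasure.singular, sub_apply,
    withDensityᵥ_apply (μ.integrable_density volume) hA]

theorem TorusVectorMeasure.component_singular (μ : TorusVectorMeasure n) (i : Fin n) :
    μ.singular.component i = (μ.component i).singularPart volume := by
  ext A hA
  rw [TorusVectorMeasure.component_apply, μ.singular_apply hA, PiLp.sub_apply,
    μ.setIntegral_density_apply]
  have h := congrArg (fun s => s A)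
    ((μ.component i).singularPart_add_withDensity_rnDeriv_eq (volume : Measure _))
  simp only [add_apply] at h
  rw [withDensityᵥ_apply (SignedMeasure.integrable_rnDeriv _ _) hA,
    TorusVectorMeasure.component_apply] at h
  linarith

/-- The singular part is concentrated on a Lebesgue null set. -/
theorem TorusVectorMeasure.exists_null_singular (μ : TorusVectorMeasure n) :
    ∃ S, MeasurableSet S ∧ volume S = 0 ∧
      ∀ A, MeasurableSet A → μ.singular A = μ.singular (A ∩ S) := by
  have h : ∀ i, ∃ s, MeasurableSet s ∧ (μ.singular.component i).totalVariation sᶜ = 0 ∧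
      volume s = 0 := by
    intro i
    have h1 := (μ.component i).mutuallySingular_singularPart volume
    rw [SignedMeasure.mutuallySingular_ennreal_iff,
      VectorMeasure.ennrealToMeasure_toENNRealVectorMeasure, ← μ.component_singular] at h1
    obtain ⟨s, hs, h2, h3⟩ := h1
    exact ⟨sᶜ, hs.compl, by simpa using h2, h3⟩
  choose s hs h1 h2 using h
  -- Each component of the singular part lives on a null set `s i`; the union over the finitely many
  -- components carries the whole vector measure.
  refine ⟨⋃ i, s i, MeasurableSet.iUnion hs, measure_iUnion_null h2, fun A hA => ?_⟩
  have hS : MeasurableSet (⋃ i, s i) := MeasurableSet.iUnion hs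
  have h3 : μ.singular (A \ ⋃ i, s i) = 0 := by
    ext i
    rw [← TorusVectorMeasure.component_apply, PiLp.zero_apply, ← norm_le_zero_iff]
    refine ((μ.singular.component i).norm_le_totalVariation _).trans_eq ?_
    have : (μ.singular.component i).totalVariation (A \ ⋃ i, s i) = 0 :=
      measure_mono_null (fun x hx hx' => hx.2 (mem_iUnion.2 ⟨i, hx'⟩)) (h1 i)
    simp [Measure.real, this]
  have h4 := VectorMeasure.of_union (v := μ.singular) (A := A ∩ ⋃ i, s i) (B := A \ ⋃ i, s i)
    (disjoint_sdiff_inter.symm) (hA.inter hS) (hA.diff hS)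
  rw [inter_union_sdiff, h3, add_zero] at h4
  exact h4

/-- Each component is absolutely continuous with respect to the variation, so the componentwise
densities reconstruct `μ`. This is the polar decomposition of `μ`. -/
theorem TorusVectorMeasure.setIntegral_density_variation (μ : TorusVectorMeasure n)
    {A : Set (UnitAddTorus (Fin n))} (hA : MeasurableSet A) :
    ∫ x in A, μ.density μ.variation x ∂μ.variation = μ A := by
  ext i
  rw [μ.setIntegral_density_apply]
  have hac : μ.component i ≪ᵥ μ.variation.toENNRealVectorMeasure := by
    refine VectorMeasure.AbsolutelyContinuous.mk fun B hB h0 => ?_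
    rw [Measure.toENNRealVectorMeasure_apply_measurable hB,
      VectorMeasure.variation_apply_eq_zero hB] at h0
    rw [TorusVectorMeasure.component_apply, h0 B Subset.rfl hB, PiLp.zero_apply]
  have h := congrArg (fun s => s A) ((μ.component i).withDensityᵥ_rnDeriv_eq μ.variation hac)
  rwa [withDensityᵥ_apply (SignedMeasure.integrable_rnDeriv _ _) hA] at h

end VectorMeasureDecomposition

/-! ### The anisotropic mass as the least mass of a dominating measure. -/

section Domination

variable {n : ℕ} {W : EuclideanSpace ℝ (Fin n) → ℝ} {lam : ℝ}

/-- `W(μ) ≤ m` as measures, tested with the linear functionals below `W`. -/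
def GaugeDominated (W : EuclideanSpace ℝ (Fin n) → ℝ) (μ : TorusVectorMeasure n)
    (m : Measure (UnitAddTorus (Fin n))) : Prop :=
  ∀ z ∈ gaugePolar W, ∀ A, MeasurableSet A → inner ℝ z (μ A) ≤ m.real A

/-- A null set `S` carries the singular part. Off `S` only the absolutely continuous part is seen,
on `S` only the singular one, so the two integrals are bounded by disjoint restrictions of `m`. -/
theorem GaugeDominated.anisotropicMass_le (h : IsGauge W lam) {μ : TorusVectorMeasure n}
    {m : Measure (UnitAddTorus (Fin n))} [IsFiniteMeasure m] (hm : GaugeDominated W μ m) :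
    anisotropicMass W μ ≤ m univ := by
  obtain ⟨S, hS, hS0, hS'⟩ := μ.exists_null_singular
  have e1 : ∫⁻ x, ENNReal.ofReal (W (μ.density volume x)) ≤ m.restrict Sᶜ univ := by
    refine h.lintegral_le (μ.measurable_density _) (μ.integrable_density _) fun z hz A hA => ?_
    have h1 : ∫ x in A, inner ℝ z (μ.density volume x) =
        ∫ x in A \ S, inner ℝ z (μ.density volume x) :=
      (setIntegral_congr_set (sdiff_null_ae_eq_self hS0)).symm
    have h2 : μ.singular (A \ S) = 0 := by
      rw [hS' _ (hA.diff hS)]; simp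
    rw [μ.singular_apply (hA.diff hS), sub_eq_zero] at h2
    rw [h1, integral_inner (μ.integrable_density _).restrict, ← h2, Measure.real,
      Measure.restrict_apply hA, ← sdiff_eq]
    exact hm z hz _ (hA.diff hS)
  have e2 : ∫⁻ x, ENNReal.ofReal (W (μ.singular.density μ.singular.variation x))
      ∂μ.singular.variation ≤ m.restrict S univ := by
    refine h.lintegral_le (TorusVectorMeasure.measurable_density _ _)
      (TorusVectorMeasure.integrable_density _ _) fun z hz A hA => ?_
    rw [integral_inner (TorusVectorMeasure.integrable_density _ _).restrict,
      TorusVectorMeasure.setIntegral_density_variation _ hA, hS' A hA,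
      μ.singular_apply (hA.inter hS),
      setIntegral_measure_zero _ (measure_mono_null inter_subset_right hS0), sub_zero,
      Measure.real, Measure.restrict_apply hA]
    exact hm z hz _ (hA.inter hS)
  calc anisotropicMass W μ ≤ m.restrict Sᶜ univ + m.restrict S univ := add_le_add e1 e2
    _ = m univ := by
      rw [Measure.restrict_apply_univ, Measure.restrict_apply_univ, add_comm,
        measure_add_measure_compl hS]

/-- The witness is the measure `W(μ)` itself. With `GaugeDominated.anisotropicMass_le`, estimates of
the energy become estimates of dominating measures, with no Lebesgue decomposition involved. -/
theorem exists_gaugeDominated (h : IsGauge W lam) {μ : TorusVectorMeasure n}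
    (hμ : anisotropicMass W μ ≠ ⊤) :
    ∃ m : Measure (UnitAddTorus (Fin n)), IsFiniteMeasure m ∧ GaugeDominated W μ m ∧
      m univ = anisotropicMass W μ := by
  set σ := μ.singular.density μ.singular.variation with hσ
  set m : Measure (UnitAddTorus (Fin n)) :=
    volume.withDensity (fun x => ENNReal.ofReal (W (μ.density volume x))) +
      μ.singular.variation.withDensity (fun x => ENNReal.ofReal (W (σ x))) with hm
  have huniv : m univ = anisotropicMass W μ := by
    simp only [hm, Measure.add_apply, withDensity_apply _ MeasurableSet.univ,
      Measure.restrict_univ]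
    rfl
  have hfin : IsFiniteMeasure m := ⟨by rw [huniv]; exact hμ.lt_top⟩
  have haux : ∀ (ν : Measure (UnitAddTorus (Fin n))) (g : UnitAddTorus (Fin n) →
      EuclideanSpace ℝ (Fin n)), Measurable g → Integrable g ν → ∀ z ∈ gaugePolar W, ∀ A,
      ∫⁻ x in A, ENNReal.ofReal (W (g x)) ∂ν ≠ ⊤ →
      inner ℝ z (∫ x in A, g x ∂ν) ≤ (∫⁻ x in A, ENNReal.ofReal (W (g x)) ∂ν).toReal := by
    intro ν g hgm hg z hz A hA
    rw [← integral_inner hg.restrict]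
    have hWm : Measurable fun x => W (g x) := h.continuous.measurable.comp hgm
    rw [← integral_toReal hWm.ennreal_ofReal.aemeasurable (by simp)]
    refine integral_mono (hg.restrict.const_inner (𝕜 := ℝ) z)
      (integrable_toReal_of_lintegral_ne_top hWm.ennreal_ofReal.aemeasurable hA) fun x => ?_
    simp only [ENNReal.toReal_ofReal (h.nonneg (g x))]
    exact hz (g x)
  refine ⟨m, hfin, fun z hz A hA => ?_, huniv⟩
  have hA' : m A ≠ ⊤ := measure_ne_top m A
  have hmA : m A = (∫⁻ x in A, ENNReal.ofReal (W (μ.density volume x))) +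
      ∫⁻ x in A, ENNReal.ofReal (W (σ x)) ∂μ.singular.variation := by
    simp only [hm, Measure.add_apply, withDensity_apply _ hA]
  rw [hmA] at hA'
  obtain ⟨f1, f2⟩ := ENNReal.add_ne_top.1 hA'
  have e : μ A = (∫ x in A, μ.density volume x) +
      ∫ x in A, σ x ∂μ.singular.variation := by
    rw [hσ, TorusVectorMeasure.setIntegral_density_variation _ hA, μ.singular_apply hA]
    abel
  rw [e, inner_add_right, Measure.real, hmA, ENNReal.toReal_add f1 f2]
  exact add_le_add
    (haux _ _ (μ.measurable_density _) (μ.integrable_density _) z hz A f1)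
    (haux _ _ (TorusVectorMeasure.measurable_density _ _)
      (TorusVectorMeasure.integrable_density _ _) z hz A f2)

end Domination

/-! ### Differentiation and integration by parts on the torus. -/

section TorusCalculus

variable {n : ℕ}

theorem isOpenQuotientMap_torusProj : IsOpenQuotientMap (torusProj (n := n)) := by
  have h : IsOpenQuotientMap (Pi.map fun (_ : Fin n) (t : ℝ) => (t : UnitAddCircle)) :=
    IsOpenQuotientMap.piMap fun _ => QuotientAddGroup.isOpenQuotientMap_mk
  exact h.comp (EuclideanSpace.equiv (Fin n) ℝ).toHomeomorph.isOpenQuotientMap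

theorem torusProj_add_smul_single (p : EuclideanSpace ℝ (Fin n)) (i : Fin n) (t : ℝ) :
    torusProj (p + t • EuclideanSpace.single i (1 : ℝ)) =
      torusProj p + Pi.single i (t : UnitAddCircle) := by
  funext j
  by_cases h : j = i
  · subst h; simp [torusProj]
  · simp [torusProj, h]

/-- `w` is continuously differentiable on the torus, with gradient `g`. -/
structure HasTorusGrad (w : UnitAddTorus (Fin n) → ℝ)
    (g : UnitAddTorus (Fin n) → EuclideanSpace ℝ (Fin n)) : Prop where
  continuous : Continuous w
  continuous_grad : Continuous g
  hasDerivAt : ∀ i x, HasDerivAt (fun t : ℝ => w (x + Pi.single i (t : UnitAddCircle))) (g x i) 0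

variable {w v : UnitAddTorus (Fin n) → ℝ} {g h : UnitAddTorus (Fin n) → EuclideanSpace ℝ (Fin n)}

theorem HasTorusGrad.hasDerivAt_shift (hw : HasTorusGrad w g) (i : Fin n)
    (x : UnitAddTorus (Fin n)) (s : ℝ) :
    HasDerivAt (fun t : ℝ => w (x + Pi.single i (t : UnitAddCircle)))
      (g (x + Pi.single i (s : UnitAddCircle)) i) s := by
  have h1 := hw.hasDerivAt i (x + Pi.single i (s : UnitAddCircle))
  have h2 : HasDerivAt (fun t : ℝ => t - s) 1 s := (hasDerivAt_id s).sub_const s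
  rw [← sub_self s] at h1
  have h3 := HasDerivAt.comp (h := fun t : ℝ => t - s) s h1 h2
  rw [mul_one] at h3
  refine h3.congr_of_eventuallyEq (Filter.Eventually.of_forall fun t => ?_)
  simp only [Function.comp_apply]
  rw [add_assoc, ← Pi.single_add, ← AddCircle.coe_add, add_sub_cancel]

theorem HasTorusGrad.torusGrad_eq (hw : HasTorusGrad w g) : torusGrad w = g := by
  funext x
  ext i
  exact (hw.hasDerivAt i x).deriv

theorem IsTorusSmooth.hasTorusGrad (hw : IsTorusSmooth w) : HasTorusGrad w (torusGrad w) := by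
  have hd : Differentiable ℝ fun p : EuclideanSpace ℝ (Fin n) => w (torusProj p) :=
    hw.differentiable (by simp)
  have key : ∀ p i, HasDerivAt (fun t : ℝ => w (torusProj p + Pi.single i (t : UnitAddCircle)))
      (fderiv ℝ (fun q : EuclideanSpace ℝ (Fin n) => w (torusProj q)) p
        (EuclideanSpace.single i (1 : ℝ))) 0 := by
    intro p i
    have h1 : HasDerivAt (fun t : ℝ => p + t • EuclideanSpace.single i (1 : ℝ))
        (EuclideanSpace.single i (1 : ℝ)) 0 := by
      simpa using ((hasDerivAt_id (0 : ℝ)).smul_const (EuclideanSpace.single i (1 : ℝ))).const_add p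
    have h2 : HasFDerivAt (fun q : EuclideanSpace ℝ (Fin n) => w (torusProj q))
        (fderiv ℝ (fun q : EuclideanSpace ℝ (Fin n) => w (torusProj q)) p)
        (p + (0 : ℝ) • EuclideanSpace.single i (1 : ℝ)) := by
      simpa using (hd p).hasFDerivAt
    have h3 := h2.comp_hasDerivAt (0 : ℝ) h1
    refine h3.congr_of_eventuallyEq (Filter.Eventually.of_forall fun t => ?_)
    simp only [Function.comp_apply, torusProj_add_smul_single]
  refine ⟨?_, ?_, fun i x => ?_⟩
  · exact isOpenQuotientMap_torusProj.isQuotientMap.continuous_iff.2 hw.continuous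
  · refine isOpenQuotientMap_torusProj.isQuotientMap.continuous_iff.2 ?_
    refine (PiLp.continuous_toLp 2 _).comp (continuous_pi fun i => ?_)
    have : (fun p => deriv (fun t : ℝ => w (torusProj p + Pi.single i (t : UnitAddCircle))) 0) =
        fun p => fderiv ℝ (fun q : EuclideanSpace ℝ (Fin n) => w (torusProj q)) p
        (EuclideanSpace.single i (1 : ℝ)) := funext fun p => (key p i).deriv
    rw [this]
    exact (hw.continuous_fderiv (by simp)).clm_apply continuous_const
  · obtain ⟨p, rfl⟩ := isOpenQuotientMap_torusProj.surjective x
    have h1 := key p i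
    have h2 : torusGrad w (torusProj p) i = _ := h1.deriv
    rwa [h2]

theorem integrable_torus_of_continuous {E : Type*} [NormedAddCommGroup E]
    {f : UnitAddTorus (Fin n) → E} (hf : Continuous f)
    (μ : Measure (UnitAddTorus (Fin n))) [IsFiniteMeasure μ] : Integrable f μ :=
  hf.integrable_of_hasCompactSupport (HasCompactSupport.of_compactSpace f)

/-- The integral of a translate of `w` does not depend on the translation; differentiate it under
the integral sign. -/
theorem HasTorusGrad.integral_eq_zero (hw : HasTorusGrad w g) (i : Fin n) :
    ∫ x, g x i = 0 := by
  have hgi : Continuous fun x => g x i := by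
    exact (EuclideanSpace.proj i).continuous.comp hw.continuous_grad
  obtain ⟨C, hC⟩ := isCompact_univ.exists_bound_of_continuousOn hgi.continuousOn
  have hs : ∀ t : ℝ, Continuous fun x : UnitAddTorus (Fin n) =>
      x + Pi.single i (t : UnitAddCircle) := fun t => continuous_add_const _
  let F : ℝ → UnitAddTorus (Fin n) → ℝ := fun t x => w (x + Pi.single i (t : UnitAddCircle))
  let F' : ℝ → UnitAddTorus (Fin n) → ℝ := fun t x => g (x + Pi.single i (t : UnitAddCircle)) i
  have h1 := hasDerivAt_integral_of_dominated_loc_of_deriv_le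
    (μ := (volume : Measure (UnitAddTorus (Fin n))))
    (F := F)
    (F' := F') (x₀ := 0)
    (bound := fun _ => C) (s := univ) Filter.univ_mem
    (Filter.Eventually.of_forall fun t =>
      (hw.continuous.comp (hs t)).aestronglyMeasurable)
    (integrable_torus_of_continuous (hw.continuous.comp (hs 0)) _)
    (hgi.comp (hs 0)).aestronglyMeasurable
    (Filter.Eventually.of_forall fun x t _ => hC _ (mem_univ _))
    (integrable_const C)
    (Filter.Eventually.of_forall fun x t _ => hw.hasDerivAt_shift i x t)
  have h2 : (fun t : ℝ => ∫ x : UnitAddTorus (Fin n), w (x + Pi.single i (t : UnitAddCircle))) = fun _ => ∫ x, w x :=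
    funext fun t => integral_add_right_eq_self w _
  have h3 := h1.2
  simp only [F, F'] at h3
  rw [h2] at h3
  have h4 := h3.unique (hasDerivAt_const (0 : ℝ) (∫ x, w x))
  simpa using h4

theorem HasTorusGrad.mul (hw : HasTorusGrad w g) (hv : HasTorusGrad v h) :
    HasTorusGrad (fun x => w x * v x) (fun x => v x • g x + w x • h x) := by
  refine ⟨hw.continuous.mul hv.continuous,
    (hv.continuous.smul hw.continuous_grad).add (hw.continuous.smul hv.continuous_grad),
    fun i x => ?_⟩
  have := (hw.hasDerivAt i x).mul (hv.hasDerivAt i x)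
  refine this.congr_deriv ?_
  simp
  ring

theorem HasTorusGrad.integral_smul_eq_neg (hw : HasTorusGrad w g) (hv : HasTorusGrad v h) :
    ∫ x, w x • h x = -∫ x, v x • g x := by
  have i1 : Integrable (fun x => w x • h x) (volume : Measure (UnitAddTorus (Fin n))) :=
    integrable_torus_of_continuous (hw.continuous.smul hv.continuous_grad) _
  have i2 : Integrable (fun x => v x • g x) (volume : Measure (UnitAddTorus (Fin n))) :=
    integrable_torus_of_continuous (hv.continuous.smul hw.continuous_grad) _
  rw [eq_neg_iff_add_eq_zero, add_comm, ← integral_add i2 i1]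
  ext i
  rw [eval_integral_piLp (f := fun x => v x • g x + w x • h x) fun j => (i2.add i1).eval_piLp j]
  exact (hw.mul hv).integral_eq_zero i

end TorusCalculus

/-! ### Integrals against vector measures and distributional gradients. -/

section VectorIntegral

variable {n : ℕ}

/-- Integration against a component of a vector measure that is a difference of measures. -/
theorem inner_vectorIntegral (μ : TorusVectorMeasure n) (z : EuclideanSpace ℝ (Fin n))
    {α β : Measure (UnitAddTorus (Fin n))} [IsFiniteMeasure α] [IsFiniteMeasure β]
    (h : ∀ A, MeasurableSet A → inner ℝ z (μ A) = α.real A - β.real A)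
    {φ : UnitAddTorus (Fin n) → ℝ} (hφ : Continuous φ) :
    inner ℝ z (∫ᵛ x, φ x ∂•μ) = ∫ x, φ x ∂α - ∫ x, φ x ∂β := by
  set s : SignedMeasure (UnitAddTorus (Fin n)) := α.toSignedMeasure - β.toSignedMeasure with hs
  have hα : VectorMeasure.Integrable α.toSignedMeasure φ := by
    rw [VectorMeasure.Integrable, Measure.variation_toSignedMeasure]
    exact integrable_torus_of_continuous hφ _
  have hβ : VectorMeasure.Integrable β.toSignedMeasure φ := by
    rw [VectorMeasure.Integrable, Measure.variation_toSignedMeasure]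
    exact integrable_torus_of_continuous hφ _
  have hsφ : VectorMeasure.Integrable s φ := by
    refine MeasureTheory.Integrable.mono_measure ?_ VectorMeasure.variation_sub_le
    exact MeasureTheory.Integrable.add_measure hα hβ
  have hμφ : VectorMeasure.Integrable μ φ := integrable_torus_of_continuous hφ _
  have e1 : ∫ᵛ x, φ x ∂<•s = ∫ x, φ x ∂α - ∫ x, φ x ∂β := by
    rw [hs, VectorMeasure.integral_sub_vectorMeasure hα hβ,
      VectorMeasure.integral_toSignedMeasure, VectorMeasure.integral_toSignedMeasure]
  have e2 : innerSL ℝ z (∫ᵛ x, φ x ∂•μ) = ∫ᵛ x, φ x ∂<•s := by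
    rw [VectorMeasure.continuousLinearMap_apply_integral hμφ,
      VectorMeasure.integral_eq_setToFun_transpose hμφ,
      VectorMeasure.integral_eq_setToFun_transpose hsφ]
    -- Both integrals depend on their vector measures only through the transposes, which agree on
    -- measurable sets by `h`.
    have ht : μ.transpose ((ContinuousLinearMap.compL ℝ (EuclideanSpace ℝ (Fin n))
        (EuclideanSpace ℝ (Fin n)) ℝ (innerSL ℝ z)) ∘L ContinuousLinearMap.lsmul ℝ ℝ) =
        s.transpose (ContinuousLinearMap.lsmul ℝ ℝ).flip := by
      ext A hA
      change inner ℝ z ((1 : ℝ) • μ A) = s A • (1 : ℝ)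
      rw [one_smul, h A hA, hs, sub_apply, Measure.toSignedMeasure_apply_measurable hA,
        Measure.toSignedMeasure_apply_measurable hA]
      simp
    congr 1
    · rw [ht]
    · rw [ht]
  rw [← e1, ← e2]
  rfl

theorem vectorIntegral_withDensity {g : UnitAddTorus (Fin n) → EuclideanSpace ℝ (Fin n)}
    (hg : Continuous g) {φ : UnitAddTorus (Fin n) → ℝ} (hφ : Continuous φ) :
    ∫ᵛ x, φ x ∂•(volume : Measure (UnitAddTorus (Fin n))).withDensityᵥ g = ∫ x, φ x • g x := by
  have hgi : Integrable g (volume : Measure (UnitAddTorus (Fin n))) :=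
    integrable_torus_of_continuous hg _
  refine ext_inner_left ℝ fun z => ?_
  have hz : Continuous fun x => inner ℝ z (g x) := by fun_prop
  have hzi : Integrable (fun x => inner ℝ z (g x)) (volume : Measure (UnitAddTorus (Fin n))) :=
    integrable_torus_of_continuous hz _
  set α := (volume : Measure (UnitAddTorus (Fin n))).withDensity
    (fun x => ENNReal.ofReal (inner ℝ z (g x))) with hα
  set β := (volume : Measure (UnitAddTorus (Fin n))).withDensity
    (fun x => ENNReal.ofReal (-inner ℝ z (g x))) with hβ
  have : IsFiniteMeasure α := isFiniteMeasure_withDensity_ofReal hzi.2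
  have : IsFiniteMeasure β := isFiniteMeasure_withDensity_ofReal hzi.neg.2
  rw [inner_vectorIntegral _ z (α := α) (β := β) ?_ hφ]
  · have aux : ∀ f : UnitAddTorus (Fin n) → ℝ, Continuous f →
        ∫ x, φ x ∂(volume.withDensity fun x => ENNReal.ofReal (f x)) =
          ∫ x, max (f x) 0 * φ x := by
      intro f hf
      rw [integral_withDensity_eq_integral_toReal_smul (by fun_prop) (by simp)]
      simp [ENNReal.toReal_ofReal']
    rw [hα, hβ, aux _ hz, aux (fun x => -inner ℝ z (g x)) hz.neg, ← integral_sub, ← integral_inner]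
    · refine integral_congr_ae (Filter.Eventually.of_forall fun x => ?_)
      simp only [inner_smul_right]
      rcases le_total 0 (inner ℝ z (g x)) with h | h
      · rw [max_eq_left h, max_eq_right (by linarith)]; ring
      · rw [max_eq_right h, max_eq_left (by linarith)]; ring
    · exact integrable_torus_of_continuous (by fun_prop) _
    · exact integrable_torus_of_continuous (by fun_prop) _
    · exact integrable_torus_of_continuous (by fun_prop) _
  · intro A hA
    rw [withDensityᵥ_apply hgi hA, ← integral_inner hgi.restrict,
      integral_eq_lintegral_pos_part_sub_lintegral_neg_part hzi.restrict, Measure.real,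
      Measure.real, hα, hβ, withDensity_apply _ hA, withDensity_apply _ hA]

theorem HasTorusGrad.isDistribGradient {w : UnitAddTorus (Fin n) → ℝ}
    {g : UnitAddTorus (Fin n) → EuclideanSpace ℝ (Fin n)} (hw : HasTorusGrad w g) :
    IsDistribGradient w ((volume : Measure (UnitAddTorus (Fin n))).withDensityᵥ g) := by
  intro φ hφ
  rw [vectorIntegral_withDensity hw.continuous_grad hφ.hasTorusGrad.continuous]
  exact hw.integral_smul_eq_neg hφ.hasTorusGrad

theorem IsDistribGradient.congr_ae {u v : UnitAddTorus (Fin n) → ℝ} {μ : TorusVectorMeasure n}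
    (h : IsDistribGradient u μ) (huv : u =ᵐ[volume] v) : IsDistribGradient v μ := by
  intro φ hφ
  rw [← h φ hφ]
  refine integral_congr_ae ?_
  filter_upwards [huv] with x hx
  rw [hx]

theorem integrable_smul_torusGrad (u : TorusL2 n) {φ : UnitAddTorus (Fin n) → ℝ}
    (hφ : IsTorusSmooth φ) :
    Integrable (fun x => u x • torusGrad φ x) (volume : Measure (UnitAddTorus (Fin n))) := by
  have hu : Integrable u (volume : Measure (UnitAddTorus (Fin n))) :=
    (Lp.memLp u).integrable (by norm_num)
  obtain ⟨C, hC⟩ := isCompact_univ.exists_bound_of_continuousOn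
    hφ.hasTorusGrad.continuous_grad.continuousOn
  exact hu.smul_of_top_left (memLp_top_of_bound
    hφ.hasTorusGrad.continuous_grad.aestronglyMeasurable C
      (Filter.Eventually.of_forall fun x => hC x (mem_univ x)))

theorem IsDistribGradient.add {u v : TorusL2 n} {μ ν : TorusVectorMeasure n}
    (hu : IsDistribGradient u μ) (hv : IsDistribGradient v ν) :
    IsDistribGradient ((u + v : TorusL2 n)) (μ + ν) := by
  intro φ hφ
  rw [VectorMeasure.integral_add_vectorMeasure
    (integrable_torus_of_continuous hφ.hasTorusGrad.continuous _)
    (integrable_torus_of_continuous hφ.hasTorusGrad.continuous _), neg_add, ← hu φ hφ, ← hv φ hφ,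
    ← integral_add (integrable_smul_torusGrad u hφ) (integrable_smul_torusGrad v hφ)]
  refine integral_congr_ae ?_
  filter_upwards [Lp.coeFn_add u v] with x hx
  rw [hx, Pi.add_apply, add_smul]

theorem IsDistribGradient.smul {u : TorusL2 n} {μ : TorusVectorMeasure n}
    (hu : IsDistribGradient u μ) (c : ℝ) :
    IsDistribGradient ((c • u : TorusL2 n)) (c • μ) := by
  intro φ hφ
  rw [VectorMeasure.integral_smul_vectorMeasure, ← smul_neg, ← hu φ hφ, ← integral_smul]
  refine integral_congr_ae ?_
  filter_upwards [Lp.coeFn_smul c u] with x hx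
  rw [hx, Pi.smul_apply, smul_assoc]

end VectorIntegral

/-! ### Sublinearity of the energy. -/

section Energy

variable {n : ℕ} {W : EuclideanSpace ℝ (Fin n) → ℝ} {lam : ℝ}

/-- The anisotropic total variation energy with values in `[0, ∞]`. -/
def torusTV (W : EuclideanSpace ℝ (Fin n) → ℝ) (u : TorusL2 n) : ℝ≥0∞ :=
  ⨅ (μ : TorusVectorMeasure n) (_ : IsDistribGradient u μ), anisotropicMass W μ

theorem torusTV_le (h : IsGauge W lam) {u : TorusL2 n} {μ : TorusVectorMeasure n}
    {m : Measure (UnitAddTorus (Fin n))} [IsFiniteMeasure m] (hu : IsDistribGradient u μ)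
    (hm : GaugeDominated W μ m) : torusTV W u ≤ m univ :=
  (iInf₂_le μ hu).trans (hm.anisotropicMass_le h)

/-- Converse of `torusTV_le`. Inequalities between energies are proved by extracting a dominating
measure here, transforming it, and returning through `torusTV_le`. -/
theorem exists_of_torusTV_lt (h : IsGauge W lam) {u : TorusL2 n} {c : ℝ≥0∞}
    (hu : torusTV W u < c) :
    ∃ (μ : TorusVectorMeasure n) (m : Measure (UnitAddTorus (Fin n))), IsFiniteMeasure m ∧
      IsDistribGradient u μ ∧ GaugeDominated W μ m ∧ m univ < c := by
  obtain ⟨μ, hμ⟩ := iInf_lt_iff.1 hu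
  obtain ⟨hμu, hμc⟩ := iInf_lt_iff.1 hμ
  obtain ⟨m, hm, hd, he⟩ := exists_gaugeDominated h hμc.ne_top
  exact ⟨μ, m, hm, hμu, hd, he ▸ hμc⟩

theorem torusTV_zero (h : IsGauge W lam) : torusTV W (0 : TorusL2 n) = 0 := by
  have h0 : IsDistribGradient ((0 : TorusL2 n)) (0 : TorusVectorMeasure n) := by
    intro φ hφ
    rw [VectorMeasure.integral_zero_vectorMeasure, neg_zero]
    refine integral_eq_zero_of_ae ?_
    filter_upwards [Lp.coeFn_zero ℝ 2 (volume : Measure (UnitAddTorus (Fin n)))] with x hx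
    rw [hx, Pi.zero_apply, zero_smul, Pi.zero_apply]
  have := torusTV_le h h0 (m := 0) fun z _ A _ => by simp
  simpa using this

theorem torusTV_add_le (h : IsGauge W lam) (u v : TorusL2 n) :
    torusTV W (u + v) ≤ torusTV W u + torusTV W v := by
  refine ENNReal.le_of_forall_pos_le_add fun ε hε hfin => ?_
  obtain ⟨hu, hv⟩ := ENNReal.add_lt_top.1 hfin
  have hε' : (ε / 2 : ℝ≥0∞) ≠ 0 := by simpa using hε.ne'
  obtain ⟨μ, m, hm, h1, h2, h3⟩ := exists_of_torusTV_lt h (ENNReal.lt_add_right hu.ne hε')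
  obtain ⟨ν, k, hk, h4, h5, h6⟩ := exists_of_torusTV_lt h (ENNReal.lt_add_right hv.ne hε')
  have := torusTV_le h (h1.add h4) (m := m + k) fun z hz A hA => by
    rw [add_apply, inner_add_right, measureReal_add_apply]
    exact add_le_add (h2 z hz A hA) (h5 z hz A hA)
  refine this.trans ?_
  rw [Measure.add_apply]
  refine (add_le_add h3.le h6.le).trans_eq ?_
  rw [add_add_add_comm, ENNReal.add_halves]

theorem torusTV_smul_le (h : IsGauge W lam) {c : ℝ} (hc : 0 < c) (u : TorusL2 n) :
    torusTV W (c • u) ≤ ENNReal.ofReal c * torusTV W u := by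
  have hc0 : ENNReal.ofReal c ≠ 0 := by simpa using hc
  by_cases htop : torusTV W u = ⊤
  · rw [htop, ENNReal.mul_top hc0]; exact le_top
  refine le_of_forall_gt fun b hb => ?_
  have hb' : torusTV W u < b / ENNReal.ofReal c := by
    rw [ENNReal.lt_div_iff_mul_lt (Or.inl hc0) (Or.inl ENNReal.ofReal_ne_top), mul_comm]
    exact hb
  obtain ⟨μ, m, hm, h1, h2, h3⟩ := exists_of_torusTV_lt h hb'
  have hfin : IsFiniteMeasure (ENNReal.ofReal c • m) := Measure.smul_finite m ENNReal.ofReal_ne_top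
  have := torusTV_le h (h1.smul c) (m := ENNReal.ofReal c • m) fun z hz A hA => by
    rw [smul_apply, inner_smul_right, measureReal_ennreal_smul_apply, ENNReal.toReal_ofReal hc.le]
    exact mul_le_mul_of_nonneg_left (h2 z hz A hA) hc.le
  refine this.trans_lt ?_
  rw [Measure.smul_apply, smul_eq_mul, mul_comm]
  exact (ENNReal.lt_div_iff_mul_lt (Or.inl hc0) (Or.inl ENNReal.ofReal_ne_top)).1 h3

end Energy

/-! ### Lower semicontinuity of the energy by weak compactness. -/

section Compactness

variable {n : ℕ} {W : EuclideanSpace ℝ (Fin n) → ℝ} {lam : ℝ}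

/-- Closed sets are approximated from outside by continuous functions, and finite measures are inner
regular for closed sets. -/
theorem measure_le_of_forall_integral_le {X : Type*} [TopologicalSpace X]
    [TopologicalSpace.PseudoMetrizableSpace X] [MeasurableSpace X] [BorelSpace X] {α β : Measure X}
    [IsFiniteMeasure α] [IsFiniteMeasure β]
    (h : ∀ φ : BoundedContinuousFunction X ℝ, (∀ x, 0 ≤ φ x) → ∫ x, φ x ∂α ≤ ∫ x, φ x ∂β) :
    α ≤ β := by
  have hclosed : ∀ F : Set X, IsClosed F → α F ≤ β F := by
    intro F hF
    refine le_of_tendsto_of_tendsto' (HasOuterApproxClosed.tendsto_lintegral_apprSeq hF α)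
      (HasOuterApproxClosed.tendsto_lintegral_apprSeq hF β) fun k => ?_
    set ψ := hF.apprSeq k
    let Ψ : BoundedContinuousFunction X ℝ :=
      ψ.comp NNReal.toReal (isometry_subtype_coe.lipschitz)
    have h1 := h Ψ fun x => (ψ x).coe_nonneg
    have e : ∀ γ : Measure X, IsFiniteMeasure γ →
        ∫ x, Ψ x ∂γ = (∫⁻ x, (ψ x : ℝ≥0∞) ∂γ).toReal :=
      fun γ _ => (BoundedContinuousFunction.toReal_lintegral_coe_eq_integral ψ γ).symm
    rw [e α inferInstance, e β inferInstance] at h1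
    exact (ENNReal.toReal_le_toReal ((ψ.lintegral_lt_top_of_nnreal α).ne)
      (ψ.lintegral_lt_top_of_nnreal β).ne).1 h1
  refine Measure.le_iff.2 fun A hA => ?_
  rw [hA.measure_eq_iSup_isClosed_of_ne_top (measure_ne_top α A)]
  refine iSup₂_le fun F hFA => iSup_le fun hF => (hclosed F hF).trans (measure_mono hFA)

theorem TorusVectorMeasure.exists_sub_eq_inner (μ : TorusVectorMeasure n)
    (z : EuclideanSpace ℝ (Fin n)) :
    ∃ α β : Measure (UnitAddTorus (Fin n)), IsFiniteMeasure α ∧ IsFiniteMeasure β ∧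
      ∀ A, MeasurableSet A → inner ℝ z (μ A) = α.real A - β.real A := by
  set s : SignedMeasure (UnitAddTorus (Fin n)) :=
    μ.mapRange (innerSL ℝ z : _ →+ ℝ) (innerSL ℝ z).continuous with hs
  refine ⟨s.toJordanDecomposition.posPart, s.toJordanDecomposition.negPart, inferInstance,
    inferInstance, fun A hA => ?_⟩
  have h1 := congrArg (fun r => r A) s.toSignedMeasure_toJordanDecomposition
  simp only [JordanDecomposition.toSignedMeasure, sub_apply,
    Measure.toSignedMeasure_apply_measurable hA] at h1
  rw [h1]
  rfl

theorem GaugeDominated.inner_integral_le {μ : TorusVectorMeasure n}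
    {m : Measure (UnitAddTorus (Fin n))} [IsFiniteMeasure m] (hm : GaugeDominated W μ m)
    {z : EuclideanSpace ℝ (Fin n)} (hz : z ∈ gaugePolar W) {φ : UnitAddTorus (Fin n) → ℝ}
    (hφ : Continuous φ) (h0 : ∀ x, 0 ≤ φ x) : inner ℝ z (∫ᵛ x, φ x ∂•μ) ≤ ∫ x, φ x ∂m := by
  obtain ⟨α, β, hα, hβ, he⟩ := μ.exists_sub_eq_inner z
  rw [inner_vectorIntegral μ z he hφ]
  -- Moving `β` to the other side turns a bound on a signed measure into one between positive
  -- measures.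
  have hle : α ≤ m + β := by
    refine Measure.le_iff.2 fun A hA => ?_
    rw [← ENNReal.toReal_le_toReal (measure_ne_top _ _) (measure_ne_top _ _)]
    have h1 := hm z hz A hA
    rw [he A hA] at h1
    have h2 : (m + β).real A = m.real A + β.real A := measureReal_add_apply
    change α.real A ≤ (m + β).real A
    linarith
  have h3 := integral_mono_measure hle (Filter.Eventually.of_forall h0)
    (integrable_torus_of_continuous hφ _)
  rw [integral_add_measure (integrable_torus_of_continuous hφ _)
    (integrable_torus_of_continuous hφ _)] at h3
  linarith

/-- Tested with continuous functions, domination passes to weak limits. -/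
theorem gaugeDominated_of_inner_integral_le {μ : TorusVectorMeasure n}
    {m : Measure (UnitAddTorus (Fin n))} [IsFiniteMeasure m]
    (h : ∀ z ∈ gaugePolar W, ∀ φ : UnitAddTorus (Fin n) → ℝ, Continuous φ → (∀ x, 0 ≤ φ x) →
      inner ℝ z (∫ᵛ x, φ x ∂•μ) ≤ ∫ x, φ x ∂m) : GaugeDominated W μ m := by
  intro z hz A hA
  obtain ⟨α, β, hα, hβ, he⟩ := μ.exists_sub_eq_inner z
  have hle : α ≤ m + β := by
    refine measure_le_of_forall_integral_le fun φ h0 => ?_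
    have h1 := h z hz φ φ.continuous h0
    rw [inner_vectorIntegral μ z he φ.continuous] at h1
    rw [integral_add_measure (integrable_torus_of_continuous φ.continuous _)
      (integrable_torus_of_continuous φ.continuous _)]
    linarith
  have h2 : (m + β).real A = m.real A + β.real A := measureReal_add_apply
  have h3 : α.real A ≤ (m + β).real A := ENNReal.toReal_mono (measure_ne_top _ _) (hle A)
  rw [he A hA]
  linarith

/-- A vector measure with prescribed components. -/
theorem exists_vectorMeasure_components (p : Fin n → SignedMeasure (UnitAddTorus (Fin n))) :
    ∃ μ : TorusVectorMeasure n, ∀ i A, μ A i = p i A := by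
  let e : Fin n → (ℝ →L[ℝ] EuclideanSpace ℝ (Fin n)) := fun i =>
    (ContinuousLinearMap.id ℝ ℝ).smulRight (EuclideanSpace.single i (1 : ℝ))
  refine ⟨∑ i, (p i).mapRange (e i : ℝ →+ EuclideanSpace ℝ (Fin n)) (e i).continuous,
    fun j A => ?_⟩
  have h1 : (∑ i, (p i).mapRange (e i : ℝ →+ EuclideanSpace ℝ (Fin n)) (e i).continuous) A =
      ∑ i, p i A • EuclideanSpace.single i (1 : ℝ) := by
    rw [FunLike.coe_sum, Finset.sum_apply]
    rfl
  rw [h1]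
  simp [Finset.sum_apply, Pi.single_apply]

/-- A dominated vector measure is, up to a multiple of the dominating measure, positive in each
component. -/
theorem GaugeDominated.exists_components (h : IsGauge W lam) {μ : TorusVectorMeasure n}
    {m : FiniteMeasure (UnitAddTorus (Fin n))} (hm : GaugeDominated W μ m) :
    ∃ p : Fin n → FiniteMeasure (UnitAddTorus (Fin n)),
      (∀ i A, MeasurableSet A → μ A i =
        (p i : Measure (UnitAddTorus (Fin n))).real A - lam⁻¹ *
          (m : Measure (UnitAddTorus (Fin n))).real A) ∧
      ∀ i, ((p i).mass : ℝ) ≤ 2 * lam⁻¹ * m.mass := by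
  have hpm : ∀ i A, MeasurableSet A →
      |μ A i| ≤ lam⁻¹ * (m : Measure (UnitAddTorus (Fin n))).real A := by
    intro i A hA
    -- Both signs of `lam` times a basis vector lie in the polar set, which bounds each component of
    -- `μ` by `lam⁻¹ * m` in absolute value.
    have hlam : ‖lam • (EuclideanSpace.single i (1 : ℝ) : EuclideanSpace ℝ (Fin n))‖ ≤ lam := by
      simp [norm_smul, abs_of_pos h.pos]
    have h1 := hm _ (h.mem_polar_of_norm_le hlam) A hA
    have h2 := hm _ (h.mem_polar_of_norm_le ((norm_neg _).trans_le hlam)) A hA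
    simp only [inner_neg_left, inner_smul_left, EuclideanSpace.inner_single_left, map_one,
      one_mul, conj_trivial] at h1 h2
    rw [inv_mul_eq_div, le_div_iff₀ h.pos, ← abs_of_pos h.pos, ← abs_mul, abs_le]
    constructor <;> linarith
  have hs : ∀ i, ∃ p : FiniteMeasure (UnitAddTorus (Fin n)), ∀ A, MeasurableSet A →
      (p : Measure (UnitAddTorus (Fin n))).real A =
        μ A i + lam⁻¹ * (m : Measure (UnitAddTorus (Fin n))).real A := by
    intro i
    set s : SignedMeasure (UnitAddTorus (Fin n)) :=
      μ.component i + lam⁻¹ • (m : Measure (UnitAddTorus (Fin n))).toSignedMeasure with hs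
    have hsA : ∀ A, MeasurableSet A → s A =
        μ A i + lam⁻¹ * (m : Measure (UnitAddTorus (Fin n))).real A := by
      intro A hA
      rw [hs, add_apply, smul_apply, Measure.toSignedMeasure_apply_measurable hA]
      rfl
    have hpos : (0 : SignedMeasure (UnitAddTorus (Fin n))) ≤[univ] s := by
      refine VectorMeasure.restrict_le_restrict_of_subset_le _ _ fun A hA _ => ?_
      rw [hsA A hA, zero_apply]
      linarith [neg_abs_le (μ A i), hpm i A hA]
    refine ⟨⟨s.toMeasureOfZeroLE univ .univ hpos, inferInstance⟩, fun A hA => ?_⟩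
    rw [← hsA A hA, FiniteMeasure.toMeasure_mk, Measure.real,
      SignedMeasure.toMeasureOfZeroLE_apply s hpos .univ hA]
    simp
  choose p hp using hs
  refine ⟨p, fun i A hA => by rw [hp i A hA]; ring, fun i => ?_⟩
  have h1 := hp i univ .univ
  have h2 := (le_abs_self _).trans (hpm i univ .univ)
  change ((p i : Measure (UnitAddTorus (Fin n))).real univ) ≤
    2 * lam⁻¹ * (m : Measure (UnitAddTorus (Fin n))).real univ
  linarith

theorem continuous_integral_mul (f : UnitAddTorus (Fin n) → ℝ) (hf : Continuous f) :
    Continuous fun u : TorusL2 n => ∫ x, u x * f x := by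
  have hfm : MemLp f 2 (volume : Measure (UnitAddTorus (Fin n))) := by
    obtain ⟨C, hC⟩ := isCompact_univ.exists_bound_of_continuousOn hf.continuousOn
    exact MemLp.of_bound hf.aestronglyMeasurable C
      (Filter.Eventually.of_forall fun x => hC x (mem_univ x))
  have : (fun u : TorusL2 n => ∫ x, u x * f x) = fun u : TorusL2 n => inner ℝ (hfm.toLp f) u := by
    funext u
    rw [L2.inner_def]
    refine integral_congr_ae ?_
    filter_upwards [hfm.coeFn_toLp] with x hx
    simp [hx]
  rw [this]
  fun_prop

theorem isDistribGradient_iff {u : TorusL2 n} {μ : TorusVectorMeasure n} :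
    IsDistribGradient u μ ↔ ∀ φ : UnitAddTorus (Fin n) → ℝ, IsTorusSmooth φ → ∀ i,
      ∫ x, u x * torusGrad φ x i = -(∫ᵛ x, φ x ∂•μ) i := by
  have key : ∀ φ : UnitAddTorus (Fin n) → ℝ, IsTorusSmooth φ → ∀ i,
      (∫ x, u x • torusGrad φ x) i = ∫ x, u x * torusGrad φ x i := by
    intro φ hφ i
    rw [eval_integral_piLp (f := fun x => u x • torusGrad φ x)
      fun j => (integrable_smul_torusGrad u hφ).eval_piLp j]
    rfl
  constructor
  · intro h φ hφ i
    rw [← key φ hφ, h φ hφ]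
    rfl
  · intro h φ hφ
    ext i
    rw [key φ hφ, h φ hφ i]
    rfl

/-- Along an ultrafilter converging to `u`, the dominating measures and the shifted components of
the gradients are positive with bounded mass, so they converge weakly. The limits form a vector
measure that is the gradient of `u` and is dominated by a measure of mass at most `c`. -/
theorem torusTV_le_of_mem_closure (h : IsGauge W lam) {u : TorusL2 n} {c : NNReal}
    (hu : u ∈ closure {v : TorusL2 n | torusTV W v < c}) : torusTV W u ≤ c := by
  obtain ⟨U, hUS, hUu⟩ := mem_closure_iff_ultrafilter.1 hu
  have hex : ∀ v : TorusL2 n, torusTV W v < c → ∃ (μ : TorusVectorMeasure n)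
      (m : FiniteMeasure (UnitAddTorus (Fin n))) (p : Fin n → FiniteMeasure (UnitAddTorus (Fin n))),
      IsDistribGradient v μ ∧ GaugeDominated W μ m ∧ m.mass ≤ c ∧
      (∀ i A, MeasurableSet A → μ A i =
        (p i : Measure (UnitAddTorus (Fin n))).real A - lam⁻¹ *
          (m : Measure (UnitAddTorus (Fin n))).real A) ∧
      ∀ i, (p i).mass ≤ Real.toNNReal (2 * lam⁻¹ * c) := by
    intro v hv
    obtain ⟨μ, m, hm, h1, h2, h3⟩ := exists_of_torusTV_lt h hv
    obtain ⟨k, rfl⟩ : ∃ k : FiniteMeasure (UnitAddTorus (Fin n)),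
        (k : Measure (UnitAddTorus (Fin n))) = m := ⟨⟨m, hm⟩, rfl⟩
    obtain ⟨p, hp, hp'⟩ := h2.exists_components h
    have hmc : k.mass ≤ c := by
      rw [← ENNReal.coe_le_coe, FiniteMeasure.ennreal_mass]
      exact h3.le
    refine ⟨μ, k, p, h1, h2, hmc, hp, fun i => ?_⟩
    rw [← NNReal.coe_le_coe]
    refine ((hp' i).trans ?_).trans (Real.le_coe_toNNReal _)
    have := h.pos
    have : (k.mass : ℝ) ≤ c := by exact_mod_cast hmc
    gcongr
  choose! μ m p hμ hdom hmass hcomp hpmass using hex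
  obtain ⟨m', hm'c, hm'⟩ := (isCompact_setOfPred_finiteMeasure_le_of_compactSpace
    (UnitAddTorus (Fin n)) c).ultrafilter_le_nhds (U.map m)
    (by
      rw [Filter.le_principal_iff, Ultrafilter.coe_map, Filter.mem_map]
      exact Filter.mem_of_superset hUS fun v hv => hmass v hv)
  have hp'ex : ∀ i, ∃ q : FiniteMeasure (UnitAddTorus (Fin n)),
      Filter.Tendsto (fun v => p v i) U (nhds q) := by
    intro i
    obtain ⟨q, -, hq⟩ := (isCompact_setOfPred_finiteMeasure_le_of_compactSpace
      (UnitAddTorus (Fin n)) (Real.toNNReal (2 * lam⁻¹ * c))).ultrafilter_le_nhds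
      (U.map fun v => p v i)
      (by
        rw [Filter.le_principal_iff, Ultrafilter.coe_map, Filter.mem_map]
        exact Filter.mem_of_superset hUS fun v hv => hpmass v hv i)
    exact ⟨q, hq⟩
  choose p' hp' using hp'ex
  -- The shift by `lam⁻¹ * m` that made the components positive is undone in the limit.
  obtain ⟨μ', hμ'⟩ := exists_vectorMeasure_components fun i =>
    (p' i : Measure (UnitAddTorus (Fin n))).toSignedMeasure -
      lam⁻¹ • (m' : Measure (UnitAddTorus (Fin n))).toSignedMeasure
  have hint : ∀ (ν : TorusVectorMeasure n) (k : FiniteMeasure (UnitAddTorus (Fin n)))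
      (q : Fin n → FiniteMeasure (UnitAddTorus (Fin n))),
      (∀ i A, MeasurableSet A → ν A i =
        (q i : Measure (UnitAddTorus (Fin n))).real A - lam⁻¹ *
          (k : Measure (UnitAddTorus (Fin n))).real A) →
      ∀ φ : UnitAddTorus (Fin n) → ℝ, Continuous φ → ∀ i,
      (∫ᵛ x, φ x ∂•ν) i = ∫ x, φ x ∂(q i : Measure (UnitAddTorus (Fin n))) -
        lam⁻¹ * ∫ x, φ x ∂(k : Measure (UnitAddTorus (Fin n))) := by
    intro ν k q hν φ hφ i
    have hfin : IsFiniteMeasure (ENNReal.ofReal lam⁻¹ • (k : Measure (UnitAddTorus (Fin n)))) :=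
      Measure.smul_finite _ ENNReal.ofReal_ne_top
    have h1 := inner_vectorIntegral ν (EuclideanSpace.single i (1 : ℝ))
      (α := (q i : Measure (UnitAddTorus (Fin n))))
      (β := ENNReal.ofReal lam⁻¹ • (k : Measure (UnitAddTorus (Fin n)))) (fun A hA => by
        rw [measureReal_ennreal_smul_apply, ENNReal.toReal_ofReal (inv_pos.2 h.pos).le,
          ← hν i A hA, EuclideanSpace.inner_single_left]
        simp) hφ
    rw [integral_smul_measure, ENNReal.toReal_ofReal (inv_pos.2 h.pos).le,
      EuclideanSpace.inner_single_left] at h1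
    simpa using h1
  have hcomp' : ∀ i A, MeasurableSet A → μ' A i =
      (p' i : Measure (UnitAddTorus (Fin n))).real A - lam⁻¹ *
        (m' : Measure (UnitAddTorus (Fin n))).real A := by
    intro i A hA
    rw [hμ' i A, sub_apply, smul_apply, Measure.toSignedMeasure_apply_measurable hA,
      Measure.toSignedMeasure_apply_measurable hA, smul_eq_mul]
  have hlimm : ∀ φ : UnitAddTorus (Fin n) → ℝ, Continuous φ → Filter.Tendsto
      (fun v => ∫ x, φ x ∂(m v : Measure (UnitAddTorus (Fin n)))) U
      (nhds (∫ x, φ x ∂(m' : Measure (UnitAddTorus (Fin n))))) := fun φ hφ =>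
    FiniteMeasure.tendsto_iff_forall_integral_tendsto.1 hm'
      (BoundedContinuousFunction.mkOfCompact ⟨φ, hφ⟩)
  have hlim : ∀ φ : UnitAddTorus (Fin n) → ℝ, Continuous φ → ∀ i, Filter.Tendsto
      (fun v => (∫ᵛ x, φ x ∂•(μ v)) i) U (nhds ((∫ᵛ x, φ x ∂•μ') i)) := by
    intro φ hφ i
    rw [hint μ' m' p' hcomp' φ hφ i]
    have h1 := FiniteMeasure.tendsto_iff_forall_integral_tendsto.1 (hp' i)
      (BoundedContinuousFunction.mkOfCompact ⟨φ, hφ⟩)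
    refine (h1.sub ((hlimm φ hφ).const_mul lam⁻¹)).congr' ?_
    filter_upwards [hUS] with v hv
    exact (hint (μ v) (m v) (p v) (hcomp v hv) φ hφ i).symm
  have hgrad : IsDistribGradient u μ' := by
    refine isDistribGradient_iff.2 fun φ hφ i => ?_
    have hgi : Continuous fun x => torusGrad φ x i :=
      (EuclideanSpace.proj i).continuous.comp hφ.hasTorusGrad.continuous_grad
    have h1 : Filter.Tendsto (fun v : TorusL2 n => ∫ x, v x * torusGrad φ x i) U
        (nhds (∫ x, u x * torusGrad φ x i)) :=
      ((continuous_integral_mul _ hgi).tendsto u).mono_left hUu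
    refine tendsto_nhds_unique h1 ((hlim φ hφ.hasTorusGrad.continuous i).neg.congr' ?_)
    filter_upwards [hUS] with v hv
    exact (isDistribGradient_iff.1 (hμ v hv) φ hφ i).symm
  have hdom' : GaugeDominated W μ' m' := by
    refine gaugeDominated_of_inner_integral_le fun z hz φ hφ h0 => ?_
    have h1 : Filter.Tendsto (fun v => inner ℝ z (∫ᵛ x, φ x ∂•(μ v))) U
        (nhds (inner ℝ z (∫ᵛ x, φ x ∂•μ'))) := by
      simp only [PiLp.inner_apply]
      exact tendsto_finsetSum _ fun i _ =>
        (tendsto_const_nhds (x := z i)).inner (hlim φ hφ i)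
    refine le_of_tendsto_of_tendsto h1 (hlimm φ hφ) ?_
    filter_upwards [hUS] with v hv
    exact (hdom v hv).inner_integral_le hz hφ h0
  refine (torusTV_le h hgrad hdom').trans ?_
  rw [← FiniteMeasure.ennreal_mass]
  exact_mod_cast hm'c

theorem lowerSemicontinuous_torusTV (h : IsGauge W lam) :
    LowerSemicontinuous (torusTV W (n := n)) := by
  refine lowerSemicontinuous_iff_isClosed_preimage.2 fun c => ?_
  refine isClosed_of_closure_subset fun u hu => ?_
  refine ENNReal.le_of_forall_pos_le_add fun ε hε hc => ?_
  lift c to NNReal using hc.ne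
  -- The slack `ε` turns the closed sublevel condition into the strict one under which dominating
  -- measures were extracted.
  have h1 : torusTV W u ≤ ((c + ε : NNReal) : ℝ≥0∞) := by
    refine torusTV_le_of_mem_closure h (closure_mono (fun v hv => ?_) hu)
    refine lt_of_le_of_lt (show torusTV W v ≤ c from hv) ?_
    exact_mod_cast lt_add_of_pos_right c hε
  exact_mod_cast h1

theorem isSublinearLsc_torusTV (h : IsGauge W lam) : IsSublinearLsc (torusTV W (n := n)) :=
  ⟨torusTV_zero h, torusTV_add_le h, fun _ hc u => torusTV_smul_le h hc u,
    lowerSemicontinuous_torusTV h⟩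

end Compactness

/-! ### Smooth approximation without increase of the energy. -/

section Mollification

variable {n : ℕ} {W : EuclideanSpace ℝ (Fin n) → ℝ} {lam : ℝ}

theorem HasTorusGrad.memLp {w : UnitAddTorus (Fin n) → ℝ}
    {g : UnitAddTorus (Fin n) → EuclideanSpace ℝ (Fin n)} (hw : HasTorusGrad w g) :
    MemLp w 2 (volume : Measure (UnitAddTorus (Fin n))) := by
  obtain ⟨C, hC⟩ := isCompact_univ.exists_bound_of_continuousOn hw.continuous.continuousOn
  exact MemLp.of_bound hw.continuous.aestronglyMeasurable C
    (Filter.Eventually.of_forall fun x => hC x (mem_univ x))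

/-- Convolution on the torus. -/
def torusConv {E : Type*} [NormedAddCommGroup E] [NormedSpace ℝ E] (f : UnitAddTorus (Fin n) → E)
    (u : UnitAddTorus (Fin n) → ℝ) (x : UnitAddTorus (Fin n)) : E :=
  ∫ y, u y • f (x - y)

theorem integrable_torusConv {E : Type*} [NormedAddCommGroup E] [NormedSpace ℝ E]
    [SecondCountableTopologyEither (UnitAddTorus (Fin n)) E]
    {f : UnitAddTorus (Fin n) → E} (hf : Continuous f) {u : UnitAddTorus (Fin n) → ℝ}
    (hu : Integrable u (volume : Measure (UnitAddTorus (Fin n)))) (x : UnitAddTorus (Fin n)) :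
    Integrable (fun y => u y • f (x - y)) (volume : Measure (UnitAddTorus (Fin n))) := by
  obtain ⟨C, hC⟩ := isCompact_univ.exists_bound_of_continuousOn hf.continuousOn
  have hc : Continuous fun y => f (x - y) := hf.comp (continuous_const.sub continuous_id)
  exact hu.smul_of_top_left (memLp_top_of_bound hc.aestronglyMeasurable C
    (Filter.Eventually.of_forall fun y => hC _ (mem_univ _)))

theorem continuous_torusConv {E : Type*} [NormedAddCommGroup E] [NormedSpace ℝ E]
    [SecondCountableTopologyEither (UnitAddTorus (Fin n)) E]
    {f : UnitAddTorus (Fin n) → E} (hf : Continuous f) {u : UnitAddTorus (Fin n) → ℝ}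
    (hu : Integrable u (volume : Measure (UnitAddTorus (Fin n)))) :
    Continuous (torusConv f u) := by
  obtain ⟨C, hC⟩ := isCompact_univ.exists_bound_of_continuousOn hf.continuousOn
  refine continuous_of_dominated (bound := fun y => ‖u y‖ * C)
    (fun x => (integrable_torusConv hf hu x).aestronglyMeasurable)
    (fun x => Filter.Eventually.of_forall fun y => ?_) (hu.norm.mul_const C)
    (Filter.Eventually.of_forall fun y => ?_)
  · rw [norm_smul]
    exact mul_le_mul_of_nonneg_left (hC _ (mem_univ _)) (norm_nonneg _)
  · exact (hf.comp (continuous_id.sub continuous_const)).const_smul (u y)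

theorem HasTorusGrad.torusConv {ρ : UnitAddTorus (Fin n) → ℝ}
    {g : UnitAddTorus (Fin n) → EuclideanSpace ℝ (Fin n)} (hρ : HasTorusGrad ρ g)
    {u : UnitAddTorus (Fin n) → ℝ}
    (hu : Integrable u (volume : Measure (UnitAddTorus (Fin n)))) :
    HasTorusGrad (torusConv ρ u) (torusConv g u) := by
  refine ⟨continuous_torusConv hρ.continuous hu, continuous_torusConv hρ.continuous_grad hu,
    fun i x => ?_⟩
  have hgi : Continuous fun x => g x i :=
    (EuclideanSpace.proj i).continuous.comp hρ.continuous_grad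
  obtain ⟨C, hC⟩ := isCompact_univ.exists_bound_of_continuousOn hgi.continuousOn
  let F : ℝ → UnitAddTorus (Fin n) → ℝ := fun t y =>
    u y * ρ (x + Pi.single i (t : UnitAddCircle) - y)
  let F' : ℝ → UnitAddTorus (Fin n) → ℝ := fun t y =>
    u y * g (x + Pi.single i (t : UnitAddCircle) - y) i
  have h1 := hasDerivAt_integral_of_dominated_loc_of_deriv_le
    (μ := (volume : Measure (UnitAddTorus (Fin n)))) (F := F) (F' := F') (x₀ := 0)
    (bound := fun y => ‖u y‖ * C) (s := univ) Filter.univ_mem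
    (Filter.Eventually.of_forall fun t =>
      (integrable_torusConv hρ.continuous hu _).aestronglyMeasurable)
    (integrable_torusConv hρ.continuous hu _)
    (integrable_torusConv hgi hu _).aestronglyMeasurable
    (Filter.Eventually.of_forall fun y t _ => by
      simp only [F', norm_mul]
      exact mul_le_mul_of_nonneg_left (hC _ (mem_univ _)) (norm_nonneg _))
    (hu.norm.mul_const C)
    (Filter.Eventually.of_forall fun y t _ => by
      have h2 := (hρ.hasDerivAt_shift i (x - y) t).const_mul (u y)
      simp only [sub_add_eq_add_sub] at h2
      exact h2)
  refine h1.2.congr_deriv ?_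
  have h3 : (_root_.torusConv g u x) i = ∫ y, u y * g (x - y) i := by
    rw [_root_.torusConv, eval_integral_piLp (f := fun y => u y • g (x - y))
      fun j => (integrable_torusConv hρ.continuous_grad hu x).eval_piLp j]
    rfl
  rw [h3]
  simp [F']

theorem IsTorusSmooth.comp_sub {ρ : UnitAddTorus (Fin n) → ℝ} (hρ : IsTorusSmooth ρ)
    (x : UnitAddTorus (Fin n)) : IsTorusSmooth fun y => ρ (x - y) := by
  obtain ⟨q, rfl⟩ := isOpenQuotientMap_torusProj.surjective x
  have h1 : ∀ p : EuclideanSpace ℝ (Fin n), torusProj q - torusProj p = torusProj (q - p) := by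
    intro p
    funext i
    simp [torusProj]
  simp only [IsTorusSmooth, h1]
  have h2 : ContDiff ℝ ∞ fun p : EuclideanSpace ℝ (Fin n) => ρ (torusProj p) := hρ
  exact h2.comp (contDiff_const.sub contDiff_id)

theorem HasTorusGrad.comp_sub {ρ : UnitAddTorus (Fin n) → ℝ}
    {g : UnitAddTorus (Fin n) → EuclideanSpace ℝ (Fin n)} (hρ : HasTorusGrad ρ g)
    (x : UnitAddTorus (Fin n)) : HasTorusGrad (fun y => ρ (x - y)) (fun y => -g (x - y)) := by
  refine ⟨hρ.continuous.comp (continuous_const.sub continuous_id),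
    (hρ.continuous_grad.comp (continuous_const.sub continuous_id)).neg, fun i y => ?_⟩
  have h1 := hρ.hasDerivAt i (x - y)
  rw [← neg_zero] at h1
  have h2 := HasDerivAt.comp (h := fun t : ℝ => -t) 0 h1 (hasDerivAt_neg 0)
  refine (h2.congr_of_eventuallyEq (Filter.Eventually.of_forall fun t => ?_)).congr_deriv (by simp)
  simp only [Function.comp_apply, AddCircle.coe_neg, Pi.single_neg]
  congr 1
  abel

/-- The gradient of a mollification is the mollification of the distributional gradient. -/
theorem IsDistribGradient.torusConv_grad {u : TorusL2 n} {μ : TorusVectorMeasure n}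
    (hu : IsDistribGradient u μ) {ρ : UnitAddTorus (Fin n) → ℝ} (hρ : IsTorusSmooth ρ)
    (x : UnitAddTorus (Fin n)) :
    torusConv (torusGrad ρ) u x = ∫ᵛ y, ρ (x - y) ∂•μ := by
  have h1 := hu _ (hρ.comp_sub x)
  rw [(hρ.hasTorusGrad.comp_sub x).torusGrad_eq] at h1
  simp only [smul_neg, integral_neg, neg_inj] at h1
  exact h1

/-- By duality `W` of the mollified gradient at `x` is at most `∫ ρ (x - y) dm(y)`. Integrating in
`x` with Fubini and `∫ ρ = 1` leaves the mass of `m`. -/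
theorem GaugeDominated.integral_torusConv_le (h : IsGauge W lam) {u : TorusL2 n}
    {μ : TorusVectorMeasure n} {m : Measure (UnitAddTorus (Fin n))} [IsFiniteMeasure m]
    (hu : IsDistribGradient u μ) (hm : GaugeDominated W μ m) {ρ : UnitAddTorus (Fin n) → ℝ}
    (hρ : IsTorusSmooth ρ) (h0 : ∀ x, 0 ≤ ρ x) (h1 : ∫ x, ρ x = 1) :
    ∫ x, W (torusConv (torusGrad ρ) u x) ≤ m.real univ := by
  have hui : Integrable u (volume : Measure (UnitAddTorus (Fin n))) :=
    (Lp.memLp u).integrable (by norm_num)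
  have hρc := hρ.hasTorusGrad.continuous
  have hprod : Integrable (Function.uncurry fun x y => ρ (x - y))
      ((volume : Measure (UnitAddTorus (Fin n))).prod m) := by
    have : Continuous (Function.uncurry fun x y => ρ (x - y)) :=
      hρc.comp (continuous_fst.sub continuous_snd)
    exact this.integrable_of_hasCompactSupport (HasCompactSupport.of_compactSpace _)
  calc ∫ x, W (torusConv (torusGrad ρ) u x) ≤ ∫ x, ∫ y, ρ (x - y) ∂m := by
        refine integral_mono (integrable_torus_of_continuous (h.continuous.comp
          (continuous_torusConv hρ.hasTorusGrad.continuous_grad hui)) _)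
          hprod.integral_prod_left fun x => ?_
        refine h.le_of_forall_polar fun z hz => ?_
        rw [hu.torusConv_grad hρ]
        exact hm.inner_integral_le hz (hρc.comp (continuous_const.sub continuous_id))
          fun y => h0 _
    _ = ∫ y, (∫ x, ρ (x - y)) ∂m := integral_integral_swap hprod
    _ = m.real univ := by
        simp only [integral_sub_right_eq_self ρ, h1]
        simp

instance : Fact ((2 : ℝ≥0∞) ≠ ⊤) := ⟨by simp⟩

/-- Translation `x ↦ u (x - y)` on `L²(𝕋ⁿ)`. -/
def torusTranslate (y : UnitAddTorus (Fin n)) (u : TorusL2 n) : TorusL2 n :=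
  DomAddAct.mk (-y) +ᵥ u

theorem torusTranslate_ae (y : UnitAddTorus (Fin n)) (u : TorusL2 n) :
    torusTranslate y u =ᵐ[volume] fun x => u (x - y) := by
  filter_upwards [DomAddAct.vadd_Lp_ae_eq (DomAddAct.mk (-y)) u] with x hx
  rw [torusTranslate, hx]
  simp [sub_eq_neg_add]

theorem continuous_torusTranslate (u : TorusL2 n) :
    Continuous fun y : UnitAddTorus (Fin n) => torusTranslate y u := by
  have : ContinuousVAdd (UnitAddTorus (Fin n))ᵈᵃᵃ (TorusL2 n) := Lp.instContinuousVAddDomAddAct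
  have h1 : Continuous fun y : UnitAddTorus (Fin n) => DomAddAct.mk (-y) :=
    DomAddAct.continuous_mk.comp continuous_neg
  exact h1.vadd continuous_const

/-- Mollification is an average of translations. -/
theorem torusConv_ae_eq_integral_translate {ρ : UnitAddTorus (Fin n) → ℝ} (hρ : Continuous ρ)
    (u : TorusL2 n) :
    torusConv ρ u =ᵐ[volume] (∫ y, ρ y • torusTranslate y u : TorusL2 n) := by
  have hui : Integrable u (volume : Measure (UnitAddTorus (Fin n))) :=
    (Lp.memLp u).integrable (by norm_num)
  have hSi : Integrable (∫ y, ρ y • torusTranslate y u : TorusL2 n)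
      (volume : Measure (UnitAddTorus (Fin n))) := (Lp.memLp _).integrable (by norm_num)
  have hti : Integrable (fun y => ρ y • torusTranslate y u)
      (volume : Measure (UnitAddTorus (Fin n))) :=
    integrable_torus_of_continuous (hρ.smul (continuous_torusTranslate u)) _
  have hwc := continuous_torusConv hρ hui
  have hneg : (volume : Measure (UnitAddTorus (Fin n))).IsNegInvariant :=
    Measure.IsAddHaarMeasure.isNegInvariant_of_regular _
  -- The Bochner integral is taken in `L²`, where points cannot be evaluated; pairing with
  -- indicators of sets `A` reduces the identity to Fubini.
  refine Integrable.ae_eq_of_forall_setIntegral_eq _ _ (integrable_torus_of_continuous hwc _) hSi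
    fun A hA _ => ?_
  have hAfin : (volume : Measure (UnitAddTorus (Fin n))) A ≠ ⊤ := measure_ne_top _ _
  have hconv : Integrable (fun p : UnitAddTorus (Fin n) × UnitAddTorus (Fin n) =>
      ρ p.2 * u (p.1 - p.2)) (((volume : Measure (UnitAddTorus (Fin n)))).prod volume) :=
    (integrable_torus_of_continuous hρ volume).convolution_integrand
      (ContinuousLinearMap.mul ℝ ℝ) hui
  have hconv' : Integrable (Function.uncurry fun x y => ρ y * u (x - y))
      ((volume.restrict A).prod (volume : Measure (UnitAddTorus (Fin n)))) := by
    refine hconv.mono_measure (Measure.prod_mono Measure.restrict_le_self le_rfl)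
  calc ∫ x in A, torusConv ρ u x = ∫ x in A, ∫ y, ρ y * u (x - y) := by
        refine integral_congr_ae (Filter.Eventually.of_forall fun x => ?_)
        simp only [torusConv]
        rw [← integral_sub_left_eq_self _ _ x]
        simp [mul_comm]
    _ = ∫ y, ∫ x in A, ρ y * u (x - y) := integral_integral_swap hconv'
    _ = ∫ y, inner ℝ (indicatorConstLp 2 hA hAfin (1 : ℝ)) (ρ y • torusTranslate y u) := by
        refine integral_congr_ae (Filter.Eventually.of_forall fun y => ?_)
        simp only
        rw [L2.inner_indicatorConstLp_one, integral_const_mul]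
        refine Eq.symm ((integral_congr_ae (ae_restrict_of_ae (Lp.coeFn_smul _ _))).trans ?_)
        simp only [Pi.smul_apply, smul_eq_mul]
        rw [integral_const_mul]
        congr 1
        exact integral_congr_ae (ae_restrict_of_ae (torusTranslate_ae y u))
    _ = inner ℝ (indicatorConstLp 2 hA hAfin (1 : ℝ)) (∫ y, ρ y • torusTranslate y u) :=
        integral_inner hti _
    _ = ∫ x in A, (∫ y, ρ y • torusTranslate y u : TorusL2 n) x :=
        L2.inner_indicatorConstLp_one hA hAfin _

/-- A smooth function on the torus with a strict maximum at the origin. -/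
theorem exists_torusPeak (n : ℕ) : ∃ c : UnitAddTorus (Fin n) → ℝ, IsTorusSmooth c ∧
    (∀ x, 0 ≤ c x) ∧ 0 < c 0 ∧ ∀ x, x ≠ 0 → c x < c 0 := by
  have hper : Function.Periodic (fun t : ℝ => Real.cos (2 * Real.pi * t)) 1 := by
    intro t
    simp only [mul_add, mul_one, Real.cos_add_two_pi]
  let k : UnitAddCircle → ℝ := hper.lift
  have hk : ∀ t : ℝ, k (t : UnitAddCircle) = Real.cos (2 * Real.pi * t) := fun t =>
    hper.lift_coe t
  have hk0 : k 0 = 1 := by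
    rw [← AddCircle.coe_zero, hk]; simp
  have hk1 : ∀ y, k y ≤ 1 := by
    intro y
    obtain ⟨t, rfl⟩ := QuotientAddGroup.mk_surjective y
    exact (hk t).trans_le (Real.cos_le_one _)
  have hk2 : ∀ y, -1 ≤ k y := by
    intro y
    obtain ⟨t, rfl⟩ := QuotientAddGroup.mk_surjective y
    exact (Real.neg_one_le_cos _).trans_eq (hk t).symm
  have hk3 : ∀ y, y ≠ 0 → k y < 1 := by
    intro y hy
    refine lt_of_le_of_ne (hk1 y) fun he => hy ?_
    obtain ⟨t, rfl⟩ := QuotientAddGroup.mk_surjective y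
    have h1 : Real.cos (2 * Real.pi * t) = 1 := (hk t).symm.trans he
    obtain ⟨j, hj⟩ := (Real.cos_eq_one_iff _).1 h1
    have h2 : (j : ℝ) = t := by
      have := Real.two_pi_pos
      have h3 : 2 * Real.pi * ((j : ℝ) - t) = 0 := by linarith
      rcases mul_eq_zero.1 h3 with h4 | h4 <;> linarith
    change ((t : ℝ) : UnitAddCircle) = 0
    rw [AddCircle.coe_eq_zero_iff]
    exact ⟨j, by simpa using h2⟩
  -- Each summand is nonnegative and is maximal only at `0`; the leading `1` keeps the peak positive
  -- even for an empty sum.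
  refine ⟨fun x => 1 + ∑ i, (1 + k (x i)), ?_, fun x => ?_, ?_, fun x hx => ?_⟩
  · have : (fun p : EuclideanSpace ℝ (Fin n) => 1 + ∑ i, (1 + k (torusProj p i))) =
        fun p => 1 + ∑ i, (1 + Real.cos (2 * Real.pi * p i)) := by
      funext p
      simp only [torusProj, hk]
    simp only [IsTorusSmooth, this]
    fun_prop
  · have : 0 ≤ ∑ i, (1 + k (x i)) := Finset.sum_nonneg fun i _ => by linarith [hk2 (x i)]
    linarith
  · have : 0 ≤ ∑ i : Fin n, (1 + k ((0 : UnitAddTorus (Fin n)) i)) :=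
      Finset.sum_nonneg fun i _ => by linarith [hk2 ((0 : UnitAddTorus (Fin n)) i)]
    linarith
  · obtain ⟨j, hj⟩ := Function.ne_iff.1 hx
    refine add_lt_add_right (Finset.sum_lt_sum (fun i _ => ?_) ⟨j, Finset.mem_univ j, ?_⟩) 1
    · rw [Pi.zero_apply, hk0]
      linarith [hk1 (x i)]
    · rw [Pi.zero_apply, hk0]
      linarith [hk3 _ hj]

/-- There are smooth mollifiers. -/
theorem exists_mollifier (n : ℕ) : ∃ ρ : ℕ → UnitAddTorus (Fin n) → ℝ,
    (∀ k, IsTorusSmooth (ρ k)) ∧ (∀ k x, 0 ≤ ρ k x) ∧ (∀ k, ∫ x, ρ k x = 1) ∧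
    ∀ u : TorusL2 n, Filter.Tendsto (fun k => (∫ y, ρ k y • torusTranslate y u : TorusL2 n))
      Filter.atTop (nhds u) := by
  obtain ⟨c, hc, h0, hpos, hmax⟩ := exists_torusPeak n
  have hcc := hc.hasTorusGrad.continuous
  have hI : ∀ k : ℕ, 0 < ∫ x, c x ^ k := fun k =>
    (hcc.pow k).integral_pos_of_hasCompactSupport_nonneg_nonzero
      (HasCompactSupport.of_compactSpace _) (fun x => pow_nonneg (h0 x) k)
      (x := 0) (pow_pos hpos k).ne'
  -- Normalized powers of a function with a strict maximum at the origin concentrate there.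
  refine ⟨fun k x => (∫ x, c x ^ k)⁻¹ * c x ^ k, fun k => ?_, fun k x => ?_, fun k => ?_,
    fun u => ?_⟩
  · exact contDiff_const.mul (ContDiff.pow hc k)
  · exact mul_nonneg (inv_pos.2 (hI k)).le (pow_nonneg (h0 x) k)
  · rw [integral_const_mul, inv_mul_cancel₀ (hI k).ne']
  · have h1 := tendsto_setIntegral_pow_smul_of_unique_maximum_of_isCompact_of_continuousOn
      (μ := (volume : Measure (UnitAddTorus (Fin n)))) (s := univ) (x₀ := 0) (c := c)
      (g := fun y => torusTranslate y u) isCompact_univ hcc.continuousOn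
      (fun y _ hy => hmax y hy) (fun x _ => h0 x) hpos (by simp)
      (continuous_torusTranslate u).continuousOn
    have h2 : torusTranslate 0 u = u := by
      refine Lp.ext ?_
      filter_upwards [torusTranslate_ae 0 u] with x hx
      rw [hx, sub_zero]
    simp only [Measure.restrict_univ, h2] at h1
    refine h1.congr fun k => ?_
    rw [← integral_smul]
    simp only [mul_smul]

/-- Smooth approximation in `L²` without increase of the energy. -/
theorem exists_smooth_approx (h : IsGauge W lam) {u : TorusL2 n}
    {μ : TorusVectorMeasure n} {m : Measure (UnitAddTorus (Fin n))} [IsFiniteMeasure m]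
    (hu : IsDistribGradient u μ) (hm : GaugeDominated W μ m) :
    ∃ (w : ℕ → UnitAddTorus (Fin n) → ℝ)
      (g : ℕ → UnitAddTorus (Fin n) → EuclideanSpace ℝ (Fin n))
      (hw : ∀ k, HasTorusGrad (w k) (g k)), (∀ k, ∫ x, W (g k x) ≤ m.real univ) ∧
      Filter.Tendsto (fun k => (hw k).memLp.toLp (w k)) Filter.atTop (nhds u) := by
  obtain ⟨ρ, h1, h2, h3, h4⟩ := exists_mollifier n
  have hui : Integrable u (volume : Measure (UnitAddTorus (Fin n))) :=
    (Lp.memLp u).integrable (by norm_num)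
  refine ⟨fun k => torusConv (ρ k) u, fun k => torusConv (torusGrad (ρ k)) u,
    fun k => (h1 k).hasTorusGrad.torusConv hui,
    fun k => hm.integral_torusConv_le h hu (h1 k) (h2 k) (h3 k), ?_⟩
  refine (h4 u).congr fun k => Lp.ext ?_
  exact (torusConv_ae_eq_integral_translate (h1 k).hasTorusGrad.continuous u).symm.trans
    (MemLp.coeFn_toLp _).symm

end Mollification

/-! ### Submodularity of the energy. -/

section Submodularity

variable {n : ℕ} {W : EuclideanSpace ℝ (Fin n) → ℝ} {lam : ℝ}
  {w v : UnitAddTorus (Fin n) → ℝ} {g h : UnitAddTorus (Fin n) → EuclideanSpace ℝ (Fin n)}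

theorem torusTV_le_integral (hW : IsGauge W lam) (hw : HasTorusGrad w g) :
    torusTV W (hw.memLp.toLp w) ≤ ENNReal.ofReal (∫ x, W (g x)) := by
  have hgi : Integrable g (volume : Measure (UnitAddTorus (Fin n))) :=
    integrable_torus_of_continuous hw.continuous_grad _
  have hWg : Integrable (fun x => W (g x)) (volume : Measure (UnitAddTorus (Fin n))) :=
    integrable_torus_of_continuous (hW.continuous.comp hw.continuous_grad) _
  have hfin := isFiniteMeasure_withDensity_ofReal hWg.2
  have hu := hw.isDistribGradient.congr_ae (MemLp.coeFn_toLp hw.memLp).symm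
  refine (torusTV_le hW hu (m := volume.withDensity fun x => ENNReal.ofReal (W (g x)))
    fun z hz A hA => ?_).trans_eq ?_
  · rw [withDensityᵥ_apply hgi hA, ← integral_inner hgi.restrict, Measure.real,
      withDensity_apply _ hA, ← ofReal_integral_eq_lintegral_ofReal hWg.restrict
        (Filter.Eventually.of_forall fun x => hW.nonneg _),
      ENNReal.toReal_ofReal (integral_nonneg fun x => hW.nonneg _)]
    exact integral_mono (hgi.restrict.const_inner (𝕜 := ℝ) z) hWg.restrict fun x => hz (g x)
  · rw [withDensity_apply _ MeasurableSet.univ, Measure.restrict_univ,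
      ofReal_integral_eq_lintegral_ofReal hWg (Filter.Eventually.of_forall fun x => hW.nonneg _)]

/-- With `η` close to `min(·, 0)` the new function is a smooth substitute for `w ⊓ v`. When `η'`
lies in `[0, 1]`, its gradient is a pointwise convex combination of the two gradients. -/
theorem HasTorusGrad.interpolate (hw : HasTorusGrad w g) (hv : HasTorusGrad v h) {η η' : ℝ → ℝ}
    (hη : ∀ s, HasDerivAt η (η' s) s) (hη' : Continuous η') :
    HasTorusGrad (fun x => v x + η (w x - v x))
      (fun x => (1 - η' (w x - v x)) • h x + η' (w x - v x) • g x) := by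
  have hηc : Continuous η := continuous_iff_continuousAt.2 fun s => (hη s).continuousAt
  have h1 := hw.continuous
  have h2 := hv.continuous
  have h3 := hw.continuous_grad
  have h4 := hv.continuous_grad
  refine ⟨by fun_prop, by fun_prop, fun i x => ?_⟩
  have a1 := hv.hasDerivAt i x
  have a2 := (hw.hasDerivAt i x).sub a1
  have e : w x - v x = ((fun t : ℝ => w (x + Pi.single i (t : UnitAddCircle))) -
      fun t : ℝ => v (x + Pi.single i (t : UnitAddCircle))) 0 := by
    simp
  have a3 := hη (w x - v x)
  rw [e] at a3
  refine (a1.add (a3.comp (0 : ℝ) a2)).congr_deriv ?_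
  rw [← e]
  simp
  ring

/-- `M` and `N` carry complementary weights, so adding the two convexity inequalities for `W` at
each point restores `W (g x) + W (h x)`. -/
theorem torusTV_interpolate_add_le (hW : IsGauge W lam) (hw : HasTorusGrad w g)
    (hv : HasTorusGrad v h) {M N : UnitAddTorus (Fin n) → ℝ} {t : UnitAddTorus (Fin n) → ℝ}
    (ht : ∀ x, 0 ≤ t x ∧ t x ≤ 1)
    (hM : HasTorusGrad M fun x => (1 - t x) • h x + t x • g x)
    (hN : HasTorusGrad N fun x => (1 - t x) • g x + t x • h x) :
    torusTV W (hM.memLp.toLp M) + torusTV W (hN.memLp.toLp N) ≤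
      ENNReal.ofReal (∫ x, W (g x)) + ENNReal.ofReal (∫ x, W (h x)) := by
  have hi : ∀ {f : UnitAddTorus (Fin n) → ℝ} {k : UnitAddTorus (Fin n) →
      EuclideanSpace ℝ (Fin n)}, HasTorusGrad f k → Integrable (fun x => W (k x))
      (volume : Measure (UnitAddTorus (Fin n))) := fun hf =>
    integrable_torus_of_continuous (hW.continuous.comp hf.continuous_grad) _
  have h0 : ∀ k : UnitAddTorus (Fin n) → EuclideanSpace ℝ (Fin n), 0 ≤ ∫ x, W (k x) :=
    fun k => integral_nonneg fun x => hW.nonneg _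
  refine (add_le_add (torusTV_le_integral hW hM) (torusTV_le_integral hW hN)).trans ?_
  rw [← ENNReal.ofReal_add (h0 _) (h0 _), ← ENNReal.ofReal_add (h0 _) (h0 _),
    ← integral_add (hi hM) (hi hN), ← integral_add (hi hw) (hi hv)]
  refine ENNReal.ofReal_le_ofReal (integral_mono ((hi hM).add (hi hN)) ((hi hw).add (hi hv))
    fun x => ?_)
  have c1 := hW.convex.2 (mem_univ (h x)) (mem_univ (g x)) (sub_nonneg.2 (ht x).2) (ht x).1
    (by ring)
  have c2 := hW.convex.2 (mem_univ (g x)) (mem_univ (h x)) (sub_nonneg.2 (ht x).2) (ht x).1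
    (by ring)
  simp only [smul_eq_mul] at c1 c2
  dsimp only
  linarith

/-- A smooth approximation of `min(s, 0)`. -/
def smoothMin (δ s : ℝ) : ℝ := (s - √(s ^ 2 + δ ^ 2)) / 2

def smoothMinDeriv (δ s : ℝ) : ℝ := (1 - s / √(s ^ 2 + δ ^ 2)) / 2

theorem hasDerivAt_smoothMin {δ : ℝ} (hδ : 0 < δ) (s : ℝ) :
    HasDerivAt (smoothMin δ) (smoothMinDeriv δ s) s := by
  have hpos : 0 < s ^ 2 + δ ^ 2 := by positivity
  have h1 : HasDerivAt (fun s : ℝ => s ^ 2 + δ ^ 2) (2 * s) s := by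
    simpa using (hasDerivAt_pow 2 s).add_const (δ ^ 2)
  have h2 := ((hasDerivAt_id s).sub (h1.sqrt hpos.ne')).div_const 2
  refine h2.congr_deriv ?_
  rw [smoothMinDeriv, mul_div_mul_left _ _ two_ne_zero]

theorem continuous_smoothMinDeriv {δ : ℝ} (hδ : 0 < δ) : Continuous (smoothMinDeriv δ) := by
  have h1 : ∀ s : ℝ, √(s ^ 2 + δ ^ 2) ≠ 0 := fun s => by positivity
  unfold smoothMinDeriv
  fun_prop (disch := exact h1 _)

theorem smoothMinDeriv_mem {δ : ℝ} (hδ : 0 < δ) (s : ℝ) :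
    0 ≤ smoothMinDeriv δ s ∧ smoothMinDeriv δ s ≤ 1 := by
  have hpos : 0 < √(s ^ 2 + δ ^ 2) := by positivity
  have h1 : |s| ≤ √(s ^ 2 + δ ^ 2) := Real.abs_le_sqrt (by nlinarith [sq_nonneg δ])
  have h2 : |s / √(s ^ 2 + δ ^ 2)| ≤ 1 := by
    rw [abs_div, abs_of_pos hpos]
    exact div_le_one_of_le₀ h1 hpos.le
  have h3 := abs_le.1 h2
  unfold smoothMinDeriv
  constructor <;> linarith [h3.1, h3.2]

theorem abs_smoothMin_sub_min {δ : ℝ} (hδ : 0 < δ) (a b : ℝ) :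
    |b + smoothMin δ (a - b) - a ⊓ b| ≤ δ := by
  have h1 : |a - b| ≤ √((a - b) ^ 2 + δ ^ 2) := Real.abs_le_sqrt (by nlinarith [sq_nonneg δ])
  have h2 : √((a - b) ^ 2 + δ ^ 2) ≤ |a - b| + δ := by
    rw [Real.sqrt_le_left (by positivity)]
    nlinarith [sq_abs (a - b), abs_nonneg (a - b)]
  have h3 : a ⊓ b = b + ((a - b) - |a - b|) / 2 := by
    rcases le_total a b with h | h
    · rw [inf_eq_left.2 h, abs_of_nonpos (sub_nonpos.2 h)]
      ring
    · rw [inf_eq_right.2 h, abs_of_nonneg (sub_nonneg.2 h)]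
      ring
  rw [h3, smoothMin, abs_le]
  constructor <;> linarith

theorem LowerSemicontinuous.add_le_of_tendsto {X : Type*} [TopologicalSpace X]
    {F : X → ℝ≥0∞} (hF : LowerSemicontinuous F) {a b : X} {f g : ℕ → X} {c : ℝ≥0∞}
    (ha : Filter.Tendsto f Filter.atTop (nhds a)) (hb : Filter.Tendsto g Filter.atTop (nhds b))
    (h : ∀ k, F (f k) + F (g k) ≤ c) : F a + F b ≤ c := by
  have h1 : LowerSemicontinuous fun p : X × X => F p.1 + F p.2 :=
    (hF.comp continuous_fst).add (hF.comp continuous_snd)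
  have h2 : IsClosed {p : X × X | F p.1 + F p.2 ≤ c} :=
    lowerSemicontinuous_iff_isClosed_preimage.1 h1 c
  exact h2.mem_of_tendsto (ha.prodMk_nhds hb) (Filter.Eventually.of_forall h)

/-- Mollify both functions, replace minimum and maximum by smooth versions with parameter `δ k`
tending to `0`, and pass to the limit by lower semicontinuity. -/
theorem isSubmodular_torusTV (hW : IsGauge W lam) : IsSubmodular (torusTV W (n := n)) := by
  have hlsc := lowerSemicontinuous_torusTV (n := n) hW
  have key : ∀ (u₁ u₂ : TorusL2 n) (μ₁ μ₂ : TorusVectorMeasure n)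
      (m₁ m₂ : Measure (UnitAddTorus (Fin n))) [IsFiniteMeasure m₁] [IsFiniteMeasure m₂],
      IsDistribGradient u₁ μ₁ → IsDistribGradient u₂ μ₂ → GaugeDominated W μ₁ m₁ →
      GaugeDominated W μ₂ m₂ →
      torusTV W (u₁ ⊓ u₂) + torusTV W (u₁ ⊔ u₂) ≤ m₁ univ + m₂ univ := by
    intro u₁ u₂ μ₁ μ₂ m₁ m₂ _ _ hu₁ hu₂ hm₁ hm₂
    obtain ⟨w, g, hw, hwm, hwu⟩ := exists_smooth_approx hW hu₁ hm₁
    obtain ⟨v, h, hv, hvm, hvu⟩ := exists_smooth_approx hW hu₂ hm₂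
    set δ : ℕ → ℝ := fun k => 1 / ((k : ℝ) + 1) with hδdef
    have hδ : ∀ k, 0 < δ k := fun k => Nat.one_div_pos_of_nat
    let t : ℕ → UnitAddTorus (Fin n) → ℝ := fun k x => smoothMinDeriv (δ k) (w k x - v k x)
    have hM : ∀ k, HasTorusGrad (fun x => v k x + smoothMin (δ k) (w k x - v k x))
        (fun x => (1 - t k x) • h k x + t k x • g k x) := fun k =>
      (hw k).interpolate (hv k) (hasDerivAt_smoothMin (hδ k)) (continuous_smoothMinDeriv (hδ k))
    -- The smooth maximum is chosen so that minimum and maximum add up exactly to `w k + v k`. It is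
    -- an interpolation with `w` and `v` exchanged and `η(s) = -smoothMin(-s)`.
    have hN : ∀ k, HasTorusGrad (fun x => w k x - smoothMin (δ k) (w k x - v k x))
        (fun x => (1 - t k x) • g k x + t k x • h k x) := by
      intro k
      have hη : ∀ s, HasDerivAt (fun s => -smoothMin (δ k) (-s)) (smoothMinDeriv (δ k) (-s)) s := by
        intro s
        have h1 := (hasDerivAt_smoothMin (hδ k) (-s)).comp s (hasDerivAt_neg s)
        exact h1.neg.congr_deriv (by simp)
      have h2 := (hv k).interpolate (hw k) hη
        ((continuous_smoothMinDeriv (hδ k)).comp continuous_neg)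
      simpa only [neg_sub, ← sub_eq_add_neg] using h2
    have hwL : ∀ k, torusTV W ((hM k).memLp.toLp _) + torusTV W ((hN k).memLp.toLp _) ≤
        m₁ univ + m₂ univ := by
      intro k
      refine (torusTV_interpolate_add_le hW (hw k) (hv k)
        (fun x => smoothMinDeriv_mem (hδ k) _) (hM k) (hN k)).trans (add_le_add ?_ ?_)
      · exact (ENNReal.ofReal_le_ofReal (hwm k)).trans_eq (ofReal_measureReal)
      · exact (ENNReal.ofReal_le_ofReal (hvm k)).trans_eq (ofReal_measureReal)
    have hinf := hwu.inf_nhds hvu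
    have hMlim : Filter.Tendsto (fun k => (hM k).memLp.toLp _) Filter.atTop
        (nhds (u₁ ⊓ u₂)) := by
      refine hinf.congr_dist ?_
      have hb : ∀ k, dist ((hw k).memLp.toLp (w k) ⊓ (hv k).memLp.toLp (v k))
          ((hM k).memLp.toLp _) ≤
          (measureUnivNNReal (volume : Measure (UnitAddTorus (Fin n))) : ℝ) ^
            (2 : ℝ≥0∞).toReal⁻¹ * δ k := by
        intro k
        rw [dist_comm, dist_eq_norm]
        refine Lp.norm_le_of_ae_bound (hδ k).le ?_
        filter_upwards [Lp.coeFn_sub ((hM k).memLp.toLp _)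
            ((hw k).memLp.toLp (w k) ⊓ (hv k).memLp.toLp (v k)),
          Lp.coeFn_inf ((hw k).memLp.toLp (w k)) ((hv k).memLp.toLp (v k)),
          (hM k).memLp.coeFn_toLp, (hw k).memLp.coeFn_toLp, (hv k).memLp.coeFn_toLp]
          with x h1 h2 h3 h4 h5
        rw [h1, Pi.sub_apply, h2, Pi.inf_apply, h3, h4, h5]
        exact abs_smoothMin_sub_min (hδ k) _ _
      refine squeeze_zero (fun _ => dist_nonneg) hb ?_
      have h1 := (tendsto_one_div_add_atTop_nhds_zero_nat (𝕜 := ℝ)).const_mul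
        ((measureUnivNNReal (volume : Measure (UnitAddTorus (Fin n))) : ℝ) ^
            (2 : ℝ≥0∞).toReal⁻¹)
      rwa [mul_zero] at h1
    have hNlim : Filter.Tendsto (fun k => (hN k).memLp.toLp _) Filter.atTop
        (nhds (u₁ ⊔ u₂)) := by
      -- The limit of the maxima follows from that of the minima, since `u₁ ⊓ u₂ + u₁ ⊔ u₂ = u₁ +
      -- u₂`.
      have h1 := (hwu.add hvu).sub hMlim
      have e : u₁ + u₂ - u₁ ⊓ u₂ = u₁ ⊔ u₂ := by
        rw [← inf_add_sup u₁ u₂, add_sub_cancel_left]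
      rw [e] at h1
      refine h1.congr fun k => ?_
      rw [← MemLp.toLp_add, ← MemLp.toLp_sub]
      congr 1
      funext x
      simp only [Pi.add_apply, Pi.sub_apply]
      ring
    exact hlsc.add_le_of_tendsto hMlim hNlim hwL
  intro u v
  refine ENNReal.le_of_forall_pos_le_add fun ε hε hfin => ?_
  obtain ⟨hu, hv⟩ := ENNReal.add_lt_top.1 hfin
  have hε' : (ε / 2 : ℝ≥0∞) ≠ 0 := by simpa using hε.ne'
  obtain ⟨μ, m, hm, h1, h2, h3⟩ := exists_of_torusTV_lt hW (ENNReal.lt_add_right hu.ne hε')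
  obtain ⟨ν, k, hk, h4, h5, h6⟩ := exists_of_torusTV_lt hW (ENNReal.lt_add_right hv.ne hε')
  refine (key u v μ ν m k h1 h4 h2 h5).trans ((add_le_add h3.le h6.le).trans_eq ?_)
  rw [add_add_add_comm, ENNReal.add_halves]

end Submodularity

/-! ### Ordering the support functions, and the comparison theorem. -/

section Comparison

variable {n : ℕ}

theorem continuous_torusNorm : Continuous (torusNorm (n := n)) := by
  have : torusNorm (n := n) = fun x => √(∑ i, ‖x i‖ ^ 2) := funext torusNorm_eq
  rw [this]
  fun_prop

theorem torusNorm_zero : torusNorm (0 : UnitAddTorus (Fin n)) = 0 := by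
  simp [torusNorm_eq]

theorem torusNorm_neg (x : UnitAddTorus (Fin n)) : torusNorm (-x) = torusNorm x := by
  simp [torusNorm_eq]

theorem exists_torusNorm_sub_le {A : Set (UnitAddTorus (Fin n))} {x : UnitAddTorus (Fin n)}
    (hx : x ∈ closure A) {δ : ℝ} (hδ : 0 < δ) : ∃ y ∈ A, torusNorm (x - y) ≤ δ := by
  have h1 : {y | torusNorm (x - y) < δ} ∈ nhds x := by
    refine (isOpen_lt (continuous_torusNorm.comp (continuous_const.sub continuous_id))
      continuous_const).mem_nhds ?_
    simpa [torusNorm_zero] using hδ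
  obtain ⟨y, hy1, hy2⟩ := mem_closure_iff_nhds.1 hx _ h1
  exact ⟨y, hy2, (le_of_lt hy1)⟩

/-- The gap `δ` separates the boundaries: `ψH` is positive on the compact set `closure G.pos` and
`ψG` is negative on the compact set `closure H.neg`. -/
theorem TorusPair.closure_subset_of_nbd_le {G H : TorusPair n} {δ : ℝ} (hδ : 0 < δ)
    (h : G.nbd δ ≤ H) : closure G.pos ⊆ H.pos ∧ closure H.neg ⊆ G.neg := by
  obtain ⟨h1, h2⟩ := h
  simp only [TorusPair.nbd, torusNbd, if_pos hδ, if_neg (show ¬ 0 < -δ by linarith),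
    if_neg (show ¬ -δ = 0 by linarith), abs_neg, abs_of_pos hδ] at h1 h2
  refine ⟨fun x hx => ?_, fun x hx => ?_⟩
  · obtain ⟨y, hy, hxy⟩ := exists_torusNorm_sub_le hx hδ
    refine h1 ⟨y, hy, x - y, ?_, by simp⟩
    change torusNorm (0 - (x - y)) ≤ δ
    rwa [zero_sub, torusNorm_neg]
  · obtain ⟨y, hy, hxy⟩ := exists_torusNorm_sub_le hx hδ
    refine h2 hy ?_
    change torusNorm (y - x) ≤ δ
    rwa [← torusNorm_neg, neg_sub]

/-- A continuous function dominates, up to a factor, another one on a set whose closure lies in the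
positivity set of the first. -/
theorem exists_mul_ge_of_pos {X : Type*} [TopologicalSpace X] [CompactSpace X] {f g : X → ℝ}
    (hf : Continuous f) (hg : Continuous g) {A : Set X} (h : ∀ x ∈ closure A, 0 < f x) :
    ∃ K : ℝ, 0 < K ∧ ∀ x ∈ A, g x ≤ K * f x := by
  obtain ⟨C, hC⟩ := isCompact_univ.exists_bound_of_continuousOn hg.continuousOn
  rcases (closure A).eq_empty_or_nonempty with he | hne
  · refine ⟨1, one_pos, fun x hx => ?_⟩
    have := subset_closure hx
    simp [he] at this
  obtain ⟨y, hy, hmin⟩ := isClosed_closure.isCompact.exists_isMinOn hne hf.continuousOn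
  have hC0 : 0 ≤ C := (norm_nonneg _).trans (hC y (mem_univ _))
  have hfy := h y hy
  -- The minimum of `f` on the compact closure is positive; `C + 1` instead of `C` keeps the factor
  -- positive when `g` vanishes.
  refine ⟨(C + 1) / f y, by positivity, fun x hx => ?_⟩
  have h1 : f y ≤ f x := hmin (subset_closure hx)
  calc g x ≤ C := (le_abs_self _).trans (hC x (mem_univ _))
    _ ≤ (C + 1) / f y * f y := by rw [div_mul_cancel₀ _ hfy.ne']; linarith
    _ ≤ (C + 1) / f y * f x := by gcongr

/-- Ordered support functions after rescaling the positive and the negative part. -/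
theorem exists_support_le {G H : TorusPair n} {δ : ℝ} (hδ : 0 < δ) (h : G.nbd δ ≤ H)
    {ψG ψH : UnitAddTorus (Fin n) → ℝ} (hG : IsSupportFunction G ψG)
    (hH : IsSupportFunction H ψH) :
    ∃ K ε : ℝ, 0 < K ∧ 0 < ε ∧ ∀ x, ψG x ≤ K * (ψH x ⊔ 0) + ε * (ψH x ⊓ 0) := by
  obtain ⟨h1, h2⟩ := TorusPair.closure_subset_of_nbd_le hδ h
  obtain ⟨K, hK, hK'⟩ := exists_mul_ge_of_pos hH.lipschitz.continuous hG.lipschitz.continuous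
    (A := G.pos) fun x hx => hH.pos x (h1 hx)
  obtain ⟨L, hL, hL'⟩ := exists_mul_ge_of_pos hG.lipschitz.continuous.neg
    hH.lipschitz.continuous.neg (A := H.neg) fun x hx => neg_pos.2 (hG.neg x (h2 hx))
  -- On `G.pos` the bound is `ψG ≤ K * ψH`. On `H.neg` the bound `-ψH ≤ L * (-ψG)` means `ψG ≤ L⁻¹ *
  -- ψH`. Elsewhere `ψG ≤ 0 ≤ ψH`.
  refine ⟨K, L⁻¹, hK, inv_pos.2 hL, fun x => ?_⟩
  have hGle : x ∉ G.pos → ψG x ≤ 0 := by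
    intro hx
    by_cases hn : x ∈ G.neg
    · exact (hG.neg x hn).le
    · exact (hG.zero x (by simp [hn, hx])).le
  by_cases hHn : x ∈ H.neg
  · have h3 := hL' x hHn
    have h4 := hH.neg x hHn
    simp only [Pi.neg_apply] at h3
    rw [sup_eq_right.2 h4.le, inf_eq_left.2 h4.le, mul_zero, zero_add, inv_mul_eq_div,
      le_div_iff₀ hL]
    linarith
  · have h4 : 0 ≤ ψH x := by
      by_cases hp : x ∈ H.pos
      · exact (hH.pos x hp).le
      · exact (hH.zero x (by simp [hHn, hp])).ge
    rw [sup_eq_left.2 h4, inf_eq_right.2 h4, mul_zero, add_zero]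
    by_cases hp : x ∈ G.pos
    · exact hK' x hp
    · exact (hGle hp).trans (mul_nonneg hK.le h4)

end Comparison

end

theorem mainTheorem4 (n : ℕ) (hn : 1 ≤ n) (W : EuclideanSpace ℝ (Fin n) → ℝ)
    (hWreg : ContDiffOn ℝ 2 W {0}ᶜ)
    (hWsq : StrictConvexOn ℝ Set.univ (fun p => W p ^ 2))
    (hWconv : ConvexOn ℝ Set.univ W)
    (hWhom : ∃ lam : ℝ, 0 < lam ∧ ∀ (p : EuclideanSpace ℝ (Fin n)) (a : ℝ), 0 ≤ a →
      W (a • p) = a * W p ∧ lam * a * ‖p‖ ≤ a * W p)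
    (G H : TorusPair n) (hG : G.IsOpen) (hH : H.IsOpen)
    (hGH : ∃ δ : ℝ, 0 < δ ∧ G.nbd δ ≤ H)
    (ψG ψH : UnitAddTorus (Fin n) → ℝ)
    (hψG : IsSupportFunction G ψG) (hψH : IsSupportFunction H ψH)
    (hdomG : hψG.lipschitz.toL2 ∈ subdifferentialDom (tvEnergy W))
    (hdomH : hψH.lipschitz.toL2 ∈ subdifferentialDom (tvEnergy W)) :
    ∀ᵐ x ∂(volume : Measure (UnitAddTorus (Fin n))),
      x ∈ G.negᶜ ∩ G.posᶜ ∩ H.negᶜ ∩ H.posᶜ →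
        -(minimalSection (tvEnergy W) hψG.lipschitz.toL2 hdomG x) ≤
          -(minimalSection (tvEnergy W) hψH.lipschitz.toL2 hdomH x) := by
  obtain ⟨lam, hlam, hhom⟩ := hWhom
  have hW : IsGauge W lam := ⟨hWconv, hlam, fun p a ha => (hhom p a ha).1,
    fun p => by simpa using (hhom p 1 zero_le_one).2⟩
  obtain ⟨δ, hδ, hle⟩ := hGH
  obtain ⟨K, ε, hK, hε, hKε⟩ := exists_support_le hδ hle hψG hψH
  have hF := isSublinearLsc_torusTV (n := n) hW
  have hsub := isSubmodular_torusTV (n := n) hW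
  set u := hψG.lipschitz.toL2 with hu
  set v := hψH.lipschitz.toL2 with hv
  have hsd : subdifferential (tvEnergy W) (K • (v ⊔ 0) + ε • (v ⊓ 0)) =
      subdifferential (tvEnergy W) v := hF.subdifferential_pos_add_neg hsub v hK hε
  have hdom' : K • (v ⊔ 0) + ε • (v ⊓ 0) ∈ subdifferentialDom (tvEnergy W) := by
    change (subdifferential (tvEnergy W) (K • (v ⊔ 0) + ε • (v ⊓ 0))).Nonempty
    rw [hsd]
    exact hdomH
  -- The minimal section depends only on the subdifferential, so `ψH` may be replaced by its
  -- rescaling, which lies above `ψG`.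
  rw [← minimalSection_congr hsd hdom' hdomH]
  have hux : u =ᵐ[volume] ψG := MemLp.coeFn_toLp hψG.lipschitz.memLp
  have hvx : (K • (v ⊔ 0) + ε • (v ⊓ 0) : TorusL2 n) =ᵐ[volume]
      fun x => K * (ψH x ⊔ 0) + ε * (ψH x ⊓ 0) := by
    have hvx : v =ᵐ[volume] ψH := MemLp.coeFn_toLp hψH.lipschitz.memLp
    filter_upwards [hvx, Lp.coeFn_add (K • (v ⊔ 0)) (ε • (v ⊓ 0)), Lp.coeFn_smul K (v ⊔ 0),
      Lp.coeFn_smul ε (v ⊓ 0), Lp.coeFn_sup v 0, Lp.coeFn_inf v 0,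
      Lp.coeFn_zero ℝ 2 (volume : Measure (UnitAddTorus (Fin n)))] with x h1 h2 h3 h4 h5 h6 h7
    simp only [h1, h2, h3, h4, h5, h6, h7, Pi.add_apply, Pi.smul_apply, Pi.sup_apply,
      Pi.inf_apply, Pi.zero_apply, smul_eq_mul]
  have huv : u ≤ K • (v ⊔ 0) + ε • (v ⊓ 0) := by
    rw [← Lp.coeFn_le]
    filter_upwards [hux, hvx] with x h1 h2
    rw [h1, h2]
    exact hKε x
  -- Outside all four sets both support functions vanish, and rescaling preserves zeros.
  have hD : ∀ᵐ x ∂(volume : Measure (UnitAddTorus (Fin n))),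
      x ∈ G.negᶜ ∩ G.posᶜ ∩ H.negᶜ ∩ H.posᶜ → u x = (K • (v ⊔ 0) + ε • (v ⊓ 0) : TorusL2 n) x := by
    filter_upwards [hux, hvx] with x h1 h2 hx
    obtain ⟨⟨⟨hx1, hx2⟩, hx3⟩, hx4⟩ := hx
    rw [h1, h2, hψG.zero x (fun hx => hx.elim hx1 hx2), hψH.zero x (fun hx => hx.elim hx3 hx4)]
    simp
  filter_upwards [minimalSection_comparison hF hsub huv hD hdomG hdom'] with x hx hxD
  exact neg_le_neg (hx hxD)
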